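/- Let $\mathbb K$ be a field, let $A$ be an associative unital $\mathbb K$-algebra, let $e\in A$ be an idempotent and let $d\ge 0$ be an integer. Modules are left modules unless stated otherwise, $\langle e\rangle=AeA$, $\mathrm D=\operatorname{Hom}_{\mathbb K}(-,\mathbb K)$, and $A^{\varepsilon}=A\otimes_{\mathbb K}A^{\mathrm{op}}$, so that $A$-bimodules are $A^{\varepsilon}$-modules. An object of a derived category of modules over a ring is called perfect if it is quasi-isomorphic to a bounded complex of finitely generated projective modules. Put $\Omega_A=\operatorname{RHom}_{A^\varepsilon}(A,A^\varepsilon)\in\mathcal D(A^\varepsilon)$, a complex of bimodules via the inner multiplication on $A^\varepsilon$: if $f(m)=u\otimes v$, then $(xfy)(m)=uy\otimes xv$. For integers $i$, write $\operatorname{Ext}^i_A(M,N)=\operatorname{Hom}_{\mathcal D(A)}(M,N[i])$, so that this is $0$ for $i<0$ when $M,N$ are modules. The algebra $A$ is called *internally $d$-Calabi–Yau with respect to $e$* if (i) $\operatorname{gl.dim}A\le d$, and (ii) for each $i\in\mathbb Z$ there is a $\mathbb K$-linear isomorphism $\mathrm D\operatorname{Ext}^i_A(M,N)\cong\operatorname{Ext}^{d-i}_A(N,M)$,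 functorial in $M$ and $N$, where $M$ and $N$ range over the perfect $A$-modules such that $M$ is moreover a finite-dimensional $A/\langle e\rangle$-module. The algebra $A$ is called *bimodule internally $d$-Calabi–Yau with respect to $e$* if (i) $\operatorname{pdim}_{A^\varepsilon}A\le d$; (ii) $A$ is perfect as an object of $\mathcal D(A^\varepsilon)$; and (iii) there is a triangle $A\xrightarrow{\psi}\Omega_A[d]\to C\to A[1]$ in $\mathcal D(A^\varepsilon)$ such that $\operatorname{RHom}_A(C,M)=0$ and $\operatorname{RHom}_{A^{\mathrm{op}}}(C,N)=0$ for all $M\in\mathcal D(A)$ and $N\in\mathcal D(A^{\mathrm{op}})$ with finite-dimensional total cohomology and whose cohomology modules are modules over $A/\langle e\rangle$, respectively over $(A/\langle e\rangle)^{\mathrm{op}}$. **Statement.** If $A$ is bimodule internally $d$-Calabi–Yau with respect to $e$, then $A$ is internally $d$-Calabi–Yau with respect to $e$ (in particular $\operatorname{gl.dim}A\le d$), and moreover, for each $i\in\mathbb Z$, there is a $\mathbb K$-linear isomorphism $$\mathrm D\operatorname{Ext}^i_A(M,N)\cong\operatorname{Ext}^{d-i}_A(N,M),$$ functorial in $M$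 and $N$, where $M$ ranges over the finite-dimensional $A/\langle e\rangle$-modules and $N$ over all $A$-modules; neither need be perfect over $A$. -/

import Mathlib

open CategoryTheory
open scoped TensorProduct

universe v u

noncomputable section

namespace InternallyCY

attribute [local instance] HasDerivedCategory.standard
attribute [local instance] ModuleCat.moduleOfAlgebraModule

/-! ### Generalities on module categories over (noncommutative) rings -/

/-- The unbounded derived category `D(R)` of the category of all left `R`-modules. -/
abbrev D (R : Type u) [Ring R] := DerivedCategory (ModuleCat.{u} R)

/-- A module regarded as a stalk complex in degree `0`. -/
abbrev stalk {R : Type u} [Ring R] (M : ModuleCat.{u} R) : D R :=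
  (DerivedCategory.singleFunctor (ModuleCat.{u} R) 0).obj M

/-- Perfect objects of `D(R)`: those quasi-isomorphic to a bounded complex of finitely generated
projective left `R`-modules. -/
def IsPerfect {R : Type u} [Ring R] (X : D R) : Prop :=
  ∃ P : CochainComplex (ModuleCat.{u} R) ℤ,
    (∀ n, Module.Finite R (P.X n) ∧ Module.Projective R (P.X n)) ∧
    {n : ℤ | Nontrivial (P.X n)}.Finite ∧
    Nonempty (X ≅ DerivedCategory.Q.obj P)

/-- `gl.dim R ≤ d` (for left modules): every left `R`-module has projective dimension `≤ d`. -/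
def GlobalDimensionLE (R : Type u) [Ring R] (d : ℕ) : Prop :=
  ∀ M : ModuleCat.{u} R, HasProjectiveDimensionLE M d

/-- Restriction of scalars along a homomorphism of (noncommutative) rings is exact. -/
lemma restrictScalars_map_exact {R S : Type u} [Ring R] [Ring S] (f : R →+* S)
    (T : ShortComplex (ModuleCat.{u} S)) (h : T.Exact) :
    (T.map (ModuleCat.restrictScalars.{u} f)).Exact := by
  rw [CategoryTheory.ShortComplex.ShortExact.moduleCat_exact_iff_function_exact] at h ⊢
  exact h

instance restrictScalars_preservesFiniteLimits {R S : Type u} [Ring R] [Ring S] (f : R →+* S) :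
    Limits.PreservesFiniteLimits (ModuleCat.restrictScalars.{u} f) := by
  have := ((CategoryTheory.Functor.exact_tfae (ModuleCat.restrictScalars.{u} f)).out 1 3).mp
    (restrictScalars_map_exact f)
  exact this.1

instance restrictScalars_preservesFiniteColimits {R S : Type u} [Ring R] [Ring S] (f : R →+* S) :
    Limits.PreservesFiniteColimits (ModuleCat.restrictScalars.{u} f) := by
  have := ((CategoryTheory.Functor.exact_tfae (ModuleCat.restrictScalars.{u} f)).out 1 3).mp
    (restrictScalars_map_exact f)
  exact this.2

/-- Restriction of scalars `D(S) ⥤ D(R)` along a ring homomorphism `R → S`. -/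
def restrictD {R S : Type u} [Ring R] [Ring S] (f : R →+* S) : D S ⥤ D R :=
  (ModuleCat.restrictScalars.{u} f).mapDerivedCategory

/-- `RHom_R(X, Y) = 0`: all cohomology groups `Hom_{D(R)}(X, Y[i])` of `RHom_R(X, Y)` vanish. -/
def RHomVanishes {R : Type u} [Ring R] (X Y : D R) : Prop :=
  ∀ (i : ℤ) (f : X ⟶ (Y⟦i⟧ : D R)), f = 0

/-! ### Modules over the quotient `A / ⟨e⟩` -/

section Quotient

variable {A : Type u} [Ring A]

/-- The `A`-module `M` is an `A / ⟨e⟩`-module, i.e. it is annihilated by the two-sided ideal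
`⟨e⟩ = A e A`. -/
def IsQuotientModule (e : A) (M : ModuleCat.{u} A) : Prop :=
  ∀ a ∈ TwoSidedIdeal.span {e}, ∀ m : M, a • m = 0

variable (K : Type v) [Field K] [Algebra K A]

/-- The `A`-module `M` is finite dimensional over `K`. -/
def IsFinDim (M : ModuleCat.{u} A) : Prop := Module.Finite K M

/-- Objects of `D(A)` whose cohomology modules are all `A / ⟨e⟩`-modules and whose total cohomology
is finite dimensional over `K`. -/
def IsFinDimQuotientComplex (e : A) (X : D A) : Prop :=
  (∀ n : ℤ, IsQuotientModule e ((DerivedCategory.homologyFunctor (ModuleCat.{u} A) n).obj X)) ∧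
  (∀ n : ℤ, IsFinDim K ((DerivedCategory.homologyFunctor (ModuleCat.{u} A) n).obj X)) ∧
  {n : ℤ | Nontrivial ((DerivedCategory.homologyFunctor (ModuleCat.{u} A) n).obj X)}.Finite

end Quotient

/-! ### The functorial duality and internally Calabi--Yau algebras -/

section Internal

variable (K : Type v) [Field K] {A : Type u} [Ring A] [Algebra K A]

/-- `Ext^i_A(M, N) = Hom_{D(A)}(M, N[i])` for every integer `i`, a `K`-vector space. -/
abbrev ExtZ (M N : ModuleCat.{u} A) (i : ℤ) := stalk M ⟶ ((stalk N)⟦i⟧ : D A)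

/-- The `K`-linear map `Ext^i_A(M', N) → Ext^i_A(M, N)` induced by `f : M ⟶ M'`. -/
def extPre {M M' : ModuleCat.{u} A} (f : M ⟶ M') (N : ModuleCat.{u} A) (i : ℤ) :
    ExtZ M' N i →ₗ[K] ExtZ M N i :=
  Linear.leftComp K _ ((DerivedCategory.singleFunctor (ModuleCat.{u} A) 0).map f)

/-- The `K`-linear map `Ext^i_A(M, N) → Ext^i_A(M, N')` induced by `g : N ⟶ N'`. -/
def extPost (M : ModuleCat.{u} A) {N N' : ModuleCat.{u} A} (g : N ⟶ N') (i : ℤ) :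
    ExtZ M N i →ₗ[K] ExtZ M N' i :=
  Linear.rightComp K _ (((DerivedCategory.singleFunctor (ModuleCat.{u} A) 0).map g)⟦i⟧')

/-- A functorial isomorphism `D Ext^i_A(M, N) ≅ Ext^j_A(N, M)`, where `D = Hom_K(-, K)`, for `M` in
the full subcategory `S` and `N` in the full subcategory `T` of the category of `A`-modules:
`K`-linear isomorphisms which are natural in both `M` and `N`. -/
structure FunctorialDuality (S T : ModuleCat.{u} A → Prop) (i j : ℤ) where
  /-- the isomorphism for given modules -/
  iso (M N : ModuleCat.{u} A) (hM : S M) (hN : T N) :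
    Module.Dual K (ExtZ M N i) ≃ₗ[K] ExtZ N M j
  natural_left (M M' N : ModuleCat.{u} A) (hM : S M) (hM' : S M') (hN : T N) (f : M ⟶ M')
    (ξ : Module.Dual K (ExtZ M N i)) :
    iso M' N hM' hN (ξ ∘ₗ extPre K f N i) = extPost K N f j (iso M N hM hN ξ)
  natural_right (M N N' : ModuleCat.{u} A) (hM : S M) (hN : T N) (hN' : T N') (g : N ⟶ N')
    (ξ : Module.Dual K (ExtZ M N' i)) :
    iso M N hM hN (ξ ∘ₗ extPost K M g i) = extPre K g M j (iso M N' hM hN' ξ)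

variable (A) in
/-- `A` is internally `d`-Calabi--Yau with respect to `e`. -/
def IsInternallyCY (e : A) (d : ℕ) : Prop :=
  GlobalDimensionLE A d ∧
  ∀ i : ℤ, Nonempty (FunctorialDuality (A := A) K
    (fun M => IsPerfect (stalk M) ∧ IsFinDim K M ∧ IsQuotientModule e M)
    (fun N => IsPerfect (stalk N)) i (d - i))

end Internal

/-! ### The enveloping algebra, the bimodule dual, and bimodule internally Calabi--Yau algebras -/

section Bimodule

variable (K : Type v) [Field K] (A : Type u) [Ring A] [Algebra K A]

/-- The enveloping algebra `A ⊗_K Aᵒᵖ`; its left modules are the `A`-bimodules. -/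
abbrev Env := A ⊗[K] Aᵐᵒᵖ

/-- `A` as an `A`-bimodule. -/
def regularBimodule : ModuleCat.{u} (Env K A) :=
  letI : Module (Env K A) A := TensorProduct.Algebra.module
  ModuleCat.of (Env K A) A

/-- The underlying left `A`-module structure of an `A`-bimodule comes from `a ↦ a ⊗ 1`. -/
def leftHom : A →+* Env K A :=
  (Algebra.TensorProduct.includeLeft : A →ₐ[K] A ⊗[K] Aᵐᵒᵖ).toRingHom

/-- The underlying left `Aᵒᵖ`-module structure of an `A`-bimodule comes from `b ↦ 1 ⊗ b`. -/
def rightHom : Aᵐᵒᵖ →+* Env K A :=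
  (Algebra.TensorProduct.includeRight : Aᵐᵒᵖ →ₐ[K] A ⊗[K] Aᵐᵒᵖ).toRingHom

/-- The anti-automorphism `x ⊗ y ↦ y ⊗ x` of the enveloping algebra. -/
def envFlip : Env K A ≃ₐ[K] (Env K A)ᵐᵒᵖ :=
  ((Algebra.TensorProduct.comm K A Aᵐᵒᵖ).trans
    (Algebra.TensorProduct.congr AlgEquiv.refl (AlgEquiv.opOp K A))).trans
    (Algebra.TensorProduct.opAlgEquiv K K A Aᵐᵒᵖ)

lemma envFlip_tmul (x : A) (y : Aᵐᵒᵖ) :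
    envFlip K A (x ⊗ₜ[K] y) = MulOpposite.op (y.unop ⊗ₜ[K] MulOpposite.op x) := rfl

/-- For a ring `R`, the contravariant functor `M ↦ Hom_R(M, R)` from left `R`-modules to right
`R`-modules, the right action being `(f · s)(m) = f(m) s`. -/
def ringDual (R : Type u) [Ring R] : (ModuleCat.{u} R)ᵒᵖ ⥤ ModuleCat.{u} Rᵐᵒᵖ where
  obj M := ModuleCat.of Rᵐᵒᵖ (M.unop →ₗ[R] R)
  map φ := ModuleCat.ofHom
    { toFun := fun f => f ∘ₗ φ.unop.hom
      map_add' := fun _ _ => rfl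
      map_smul' := fun _ _ => rfl }

instance (R : Type u) [Ring R] : (ringDual R).Additive where
  map_add {M N f g} := by
    ext x
    exact LinearMap.ext fun m => map_add (show M.unop →ₗ[R] R from x) _ _

/-- The contravariant functor `M ↦ Hom_{Aᵉ}(M, Aᵉ)` from `A`-bimodules to `A`-bimodules, where the
bimodule structure on the target comes from the inner multiplication on `Aᵉ`: if `f(m) = u ⊗ v`
then `(x f y)(m) = u y ⊗ x v`. -/
def bimoduleDual : (ModuleCat.{u} (Env K A))ᵒᵖ ⥤ ModuleCat.{u} (Env K A) :=
  ringDual (Env K A) ⋙ ModuleCat.restrictScalars.{u} (envFlip K A).toAlgHom.toRingHom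

instance : (bimoduleDual K A).Additive := by
  unfold bimoduleDual; infer_instance

/-- The inner bimodule structure: with `f(m) = u ⊗ v`, one has `(x f y)(m) = u y ⊗ x v`. -/
lemma bimoduleDual_smul_apply (M : ModuleCat.{u} (Env K A)) (f : M →ₗ[Env K A] Env K A)
    (m : M) (u' v' x y : A) (h : f m = u' ⊗ₜ[K] MulOpposite.op v') :
    (show M →ₗ[Env K A] Env K A from
      ((x ⊗ₜ[K] MulOpposite.op y : Env K A) •
        (show (bimoduleDual K A).obj (Opposite.op M) from f))) m =
      (u' * y) ⊗ₜ[K] MulOpposite.op (x * v') := by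
  change f m * ((y : A) ⊗ₜ[K] MulOpposite.op x) = _
  rw [h, Algebra.TensorProduct.tmul_mul_tmul, ← MulOpposite.op_mul]

/-- The bimodule action on `A`: `(x ⊗ y) a = x a y`. -/
lemma regularBimodule_smul (x y a : A) :
    (show A from ((x ⊗ₜ[K] MulOpposite.op y : Env K A) •
      (show regularBimodule K A from a))) = x * a * y := by
  change TensorProduct.Algebra.moduleAux _ _ = _
  simp [TensorProduct.Algebra.moduleAux, ← mul_assoc]

/-- The complex `Hom_{Aᵉ}(P, Aᵉ)` of `A`-bimodules, concentrated in non-negative degrees, for a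
chain complex `P` of `A`-bimodules. -/
def dualComplex (P : ChainComplex (ModuleCat.{u} (Env K A)) ℕ) :
    CochainComplex (ModuleCat.{u} (Env K A)) ℤ :=
  HomologicalComplex.extend
    (show CochainComplex (ModuleCat.{u} (Env K A)) ℕ from
      (((bimoduleDual K A).rightOp.mapHomologicalComplex _).obj P).unop)
    ComplexShape.embeddingUpNat

/-- `Ω_A = RHom_{Aᵉ}(A, Aᵉ)` as an object of `D(Aᵉ)`, computed by a projective resolution of the
bimodule `A`. -/
def inverseDualizing : D (Env K A) :=
  DerivedCategory.Q.obj (dualComplex K A (projectiveResolution (regularBimodule K A)).complex)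

/-- `A` is bimodule internally `d`-Calabi--Yau with respect to `e`. -/
def IsBimoduleInternallyCY (e : A) (d : ℕ) : Prop :=
  HasProjectiveDimensionLE (regularBimodule K A) d ∧
  IsPerfect (stalk (regularBimodule K A)) ∧
  ∃ (C : D (Env K A))
    (ψ : stalk (regularBimodule K A) ⟶ ((inverseDualizing K A)⟦(d : ℤ)⟧ : D (Env K A)))
    (g : ((inverseDualizing K A)⟦(d : ℤ)⟧ : D (Env K A)) ⟶ C)
    (h : C ⟶ ((stalk (regularBimodule K A))⟦(1 : ℤ)⟧ : D (Env K A))),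
    Pretriangulated.Triangle.mk ψ g h ∈
      Pretriangulated.distinguishedTriangles (C := D (Env K A)) ∧
    (∀ M : D A, IsFinDimQuotientComplex K e M →
      RHomVanishes ((restrictD (leftHom K A)).obj C) M) ∧
    (∀ N : D Aᵐᵒᵖ, IsFinDimQuotientComplex K (MulOpposite.op e) N →
      RHomVanishes ((restrictD (rightHom K A)).obj C) N)

end Bimodule

end InternallyCY

end

noncomputable section

namespace InternallyCY

attribute [local instance] HasDerivedCategory.standard
attribute [local instance] ModuleCat.moduleOfAlgebraModule
attribute [local instance] ModuleCat.isScalarTower_of_algebra_moduleCat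

/-! ### Exact functors and extension groups -/

section ExactFunctors

open Limits Abelian

universe w w' t t' v₁ v₂ u₁ u₂

variable {C : Type u₁} [Category.{v₁} C] [Abelian C] {E : Type u₂} [Category.{v₂} E] [Abelian E]

/-! Extensions of modules are first turned into extensions of bimodules. The functor Hom_K(N, -)
from modules to bimodules is exact, and Hom_{Aᵉ}(A, Hom_K(N, M)) = Hom_A(N, M). Moreover Hom_K(N, I)
is acyclic for the bimodule A when I is injective, because A is projective as a right module
(`ext_homBimodule_eq_zero`). Hence Ext^i_A(N, M) = Ext^i_{Aᵉ}(A, Hom_K(N, M))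
(`extCompare_bijective`), and the bound on the global dimension follows at once.

Let L be a bounded complex of finitely generated projective bimodules representing A; its termwise
dual L^∨ represents Ω_A. For P finitely generated projective and bimodules X and DX in duality, D
Hom(P, X) = Hom(P^∨, DX) (`DualPair.dualMap_bijective`). Passing to cohomology gives D Hom(A, X[i])
= Hom(Ω_A, DX[-i]) (`DualPair.exists_duality`). When M is finite-dimensional, the trace pairing
tr(gf) identifies the dual of Hom_K(M, N) with Hom_K(N, M), for any N (`tracePairing_bijective`). So
D Ext^i_A(M, N) = Hom(Ω_A[d], Hom_K(N, M)[d - i]).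

It remains to replace Ω_A[d] by A along ψ, that is, to show that the cone C has no morphisms to
shifts of Hom_K(N, M). Morally these are the morphisms from C ⊗_A^L N to shifts of M. For N free
they form a product of groups Hom_{D(A)}(C, M[j]) = 0. The general case follows by dimension
shifting along free covers of N (`cocyclesBound_homBimodule`), which terminates because C is
represented by a bounded above complex of projectives. -/

/-- A natural transformation of exact functors induces a natural transformation on `Ext`. -/
lemma mapExactFunctor_naturality [HasExt.{w} C] [HasExt.{w'} E] [EnoughProjectives C]
    (F G : C ⥤ E) [F.Additive] [PreservesFiniteLimits F] [PreservesFiniteColimits F]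
    [G.Additive] [PreservesFiniteLimits G] [PreservesFiniteColimits G] (τ : F ⟶ G)
    {X Y : C} {n : ℕ} (e : Ext.{w} X Y n) :
    (e.mapExactFunctor F).comp (Ext.mk₀ (τ.app Y)) (add_zero n) =
      (Ext.mk₀ (τ.app X)).comp (e.mapExactFunctor G) (zero_add n) := by
  induction n generalizing X with
  | zero =>
    obtain ⟨f, rfl⟩ := (Ext.mk₀_bijective X Y).2 e
    simp [Ext.mapExactFunctor_mk₀]
  | succ n hn =>
    -- Dimension shifting: a class of positive degree is the class of a short exact sequence
    -- followed by a class of lower degree, so only degree 0 and extension classes need checking.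
    let P : ProjectivePresentation X := Classical.arbitrary _
    let S := ShortComplex.mk _ _ (kernel.condition P.f)
    have hS : S.ShortExact := { exact := ShortComplex.exact_kernel P.f }
    have : Projective S.X₂ := P.projective
    obtain ⟨e', rfl⟩ := Ext.contravariant_sequence_exact₃ hS Y e
      (Ext.eq_zero_of_projective _) (add_comm 1 n)
    have h₁ : (hS.extClass.mapExactFunctor F).comp (Ext.mk₀ (τ.app S.X₁)) (add_zero 1) =
        (Ext.mk₀ (τ.app X)).comp (hS.extClass.mapExactFunctor G) (zero_add 1) := by
      rw [Ext.mapExactFunctor_extClass, Ext.mapExactFunctor_extClass]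
      exact ShortComplex.ShortExact.extClass_naturality (hS.map_of_exact F)
        (hS.map_of_exact G) (S.mapNatTrans τ)
    rw [Ext.mapExactFunctor_comp, Ext.mapExactFunctor_comp, Ext.comp_assoc_of_third_deg_zero,
      hn e', ← Ext.comp_assoc_of_second_deg_zero, h₁, Ext.comp_assoc _ _ _ (zero_add 1) _ (by lia)]

section

variable (G : C ⥤ E) [G.Additive] [PreservesFiniteLimits G] [PreservesFiniteColimits G]

/-- If `Hom(N, -) ≅ Hom(Z, G -)` through `φ : Z ⟶ G N`, where `G` is an exact functor sending
injective objects to `Ext(Z, -)`-acyclic ones, then `Ext(N, -) ≅ Ext(Z, G -)`. -/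
lemma mk₀_comp_mapExactFunctor_bijective [HasExt.{w} C] [HasExt.{w'} E] [EnoughInjectives C]
    {N : C} {Z : E} (φ : Z ⟶ G.obj N)
    (h₀ : ∀ M : C, Function.Bijective (fun f : N ⟶ M => φ ≫ G.map f))
    (h₁ : ∀ (I : C) [Injective I] (n : ℕ) (e : Ext.{w'} Z (G.obj I) (n + 1)), e = 0)
    (M : C) (n : ℕ) :
    Function.Bijective (fun e : Ext.{w} N M n =>
      (Ext.mk₀ φ).comp (e.mapExactFunctor G) (zero_add n)) := by
  let Φ (M : C) (n : ℕ) : Ext.{w} N M n →+ Ext.{w'} Z (G.obj M) n :=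
    { toFun := fun e => (Ext.mk₀ φ).comp (e.mapExactFunctor G) (zero_add n)
      map_zero' := by simp
      map_add' := by simp }
  change Function.Bijective (Φ M n)
  induction n generalizing M with
  | zero =>
    have := ((Ext.mk₀_bijective Z (G.obj M)).comp (h₀ M))
    have h : (Φ M 0) ∘ (Ext.mk₀ : (N ⟶ M) → _) = Ext.mk₀ ∘ (fun f : N ⟶ M => φ ≫ G.map f) := by
      ext f
      simp [Φ, Ext.mapExactFunctor_mk₀]
    rw [← h] at this
    exact (Function.Bijective.of_comp_iff _ (Ext.mk₀_bijective N M)).1 this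
  | succ n hn =>
    -- Embedding M in an injective object compares two long exact sequences in which Ext^{n+1} of
    -- the middle term vanishes; the four lemma then passes from degree n to degree n + 1.
    let I : InjectivePresentation M := Classical.arbitrary _
    let S := ShortComplex.mk _ _ (cokernel.condition I.f)
    have hS : S.ShortExact := { exact := ShortComplex.exact_cokernel I.f }
    have : Injective S.X₂ := I.injective
    have hg (e : Ext.{w} N S.X₂ n) : (Φ S.X₂ n e).comp (Ext.mk₀ (G.map S.g)) (add_zero n) =
        Φ S.X₃ n (e.comp (Ext.mk₀ S.g) (add_zero n)) := by
      simp only [Φ, AddMonoidHom.coe_mk, ZeroHom.coe_mk]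
      rw [Ext.comp_assoc_of_third_deg_zero, Ext.mapExactFunctor_comp, Ext.mapExactFunctor_mk₀]
    have hδ (e : Ext.{w} N S.X₃ n) : (Φ S.X₃ n e).comp (hS.extClass.mapExactFunctor G) rfl =
        Φ S.X₁ (n + 1) (e.comp hS.extClass rfl) := by
      simp only [Φ, AddMonoidHom.coe_mk, ZeroHom.coe_mk]
      rw [Ext.comp_assoc _ _ _ _ rfl (by lia), Ext.mapExactFunctor_comp]
    exact AddMonoidHom.bijective_of_surjective_of_bijective_of_right_exact _ _ _ _
      (Φ S.X₂ n) (Φ S.X₃ n) (Φ S.X₁ (n + 1))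
      (AddMonoidHom.ext hg) (AddMonoidHom.ext fun e =>
        (congrArg (fun z => (Φ S.X₃ n e).comp z rfl)
          (Ext.mapExactFunctor_extClass G hS).symm).trans (hδ e))
      ((ShortComplex.ab_exact_iff_function_exact _).mp
        (Ext.covariant_sequence_exact₃' N hS n (n + 1) rfl))
      ((ShortComplex.ab_exact_iff_function_exact _).mp
        (Ext.covariant_sequence_exact₃' Z (hS.map_of_exact G) n (n + 1) rfl))
      (hn _).surjective (hn _)
      (fun x₁ => Ext.covariant_sequence_exact₁ _ hS x₁ (Ext.eq_zero_of_injective _) rfl)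
      (fun y₁ => Ext.covariant_sequence_exact₁ _ (hS.map_of_exact G) y₁ (h₁ _ _ _) rfl)

end

/-! ### Extensions in all integer degrees, inside the derived category. -/

section Derived

open DerivedCategory

variable [HasDerivedCategory.{t} C] [HasDerivedCategory.{t'} E] (K : Type v) [Ring K]
  [Linear K C] [Linear K E]

/-- For i < 0 the target is concentrated in degree -i > 0, so the t-structure kills the morphism.
This covers the integer degrees that `Ext`, indexed by ℕ, does not see. -/
lemma shiftedHom_single_eq_zero {X Y : C} {i : ℤ} (hi : i < 0)
    (f : (singleFunctor C 0).obj X ⟶ ((singleFunctor C 0).obj Y)⟦i⟧) : f = 0 := by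
  have : (DerivedCategory.TStructure.t).IsGE (((singleFunctor C 0).obj Y)⟦i⟧) (-i) :=
    DerivedCategory.TStructure.t.isGE_shift _ 0 i (-i) (by lia)
  exact DerivedCategory.TStructure.t.zero f 0 (-i) (by lia)

/-- For an exact functor `G` and `φ : Z ⟶ G N`, the map `Ext^i(N, M) → Ext^i(Z, G M)` induced by
applying `G` and composing with `φ`, in terms of the derived categories. -/
def derivedMap (G : C ⥤ E) [G.Additive] [PreservesFiniteLimits G] [PreservesFiniteColimits G]
    [G.Linear K] {N : C} {Z : E} (φ : Z ⟶ G.obj N) (M : C) (i : ℤ) :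
    ((singleFunctor C 0).obj N ⟶ ((singleFunctor C 0).obj M)⟦i⟧) →ₗ[K]
      ((singleFunctor E 0).obj Z ⟶ ((singleFunctor E 0).obj (G.obj M))⟦i⟧) where
  toFun x := (singleFunctor E 0).map φ ≫ (G.mapDerivedCategorySingleFunctor 0).inv.app N ≫
    ShiftedHom.map x G.mapDerivedCategory ≫
      ((G.mapDerivedCategorySingleFunctor 0).hom.app M)⟦i⟧'
  map_add' x y := by simp [ShiftedHom.map]
  map_smul' c x := by simp [ShiftedHom.map, Functor.map_smul]

variable (G : C ⥤ E) [G.Additive] [PreservesFiniteLimits G] [PreservesFiniteColimits G]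
    [G.Linear K]

lemma derivedMap_hom [HasExt.{w} C] [HasExt.{w'} E] {N : C} {Z : E} (φ : Z ⟶ G.obj N) (M : C)
    {n : ℕ} (e : Ext.{w} N M n) :
    derivedMap K G φ M n e.hom =
      ((Ext.mk₀ φ).comp (e.mapExactFunctor G) (zero_add n) : Ext.{w'} _ _ _).hom := by
  rw [Ext.comp_hom, Ext.mapExactFunctor_hom, Ext.mk₀_hom]
  exact (ShiftedHom.mk₀_comp 0 rfl _ _).symm

lemma derivedMap_bijective [HasExt.{w} C] [HasExt.{w'} E] [EnoughInjectives C]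
    {N : C} {Z : E} (φ : Z ⟶ G.obj N)
    (h₀ : ∀ M : C, Function.Bijective (fun f : N ⟶ M => φ ≫ G.map f))
    (h₁ : ∀ (I : C) [Injective I] (n : ℕ) (e : Ext.{w'} Z (G.obj I) (n + 1)), e = 0)
    (M : C) (i : ℤ) :
    Function.Bijective (derivedMap K G φ M i) := by
  by_cases hi : i < 0
  · exact ⟨fun x y _ => by rw [shiftedHom_single_eq_zero hi x, shiftedHom_single_eq_zero hi y],
      fun y => ⟨0, by rw [shiftedHom_single_eq_zero hi y, map_zero]⟩⟩
  · obtain ⟨n, rfl⟩ := Int.eq_ofNat_of_zero_le (not_lt.1 hi)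
    have h := (Ext.homEquiv : Ext.{w'} Z (G.obj M) n ≃ _).bijective.comp
      (mk₀_comp_mapExactFunctor_bijective G φ h₀ h₁ M n)
    have h' : (derivedMap K G φ M n) ∘ (Ext.homEquiv : Ext.{w} N M n ≃ _) =
        (Ext.homEquiv : Ext.{w'} Z (G.obj M) n ≃ _) ∘ (fun e : Ext.{w} N M n =>
          (Ext.mk₀ φ).comp (e.mapExactFunctor G) (zero_add n)) := by
      ext e
      exact derivedMap_hom K G φ M e
    rw [← h'] at h
    exact (Function.Bijective.of_comp_iff _ (Ext.homEquiv).bijective).1 h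

lemma derivedMap_naturality_right {N : C} {Z : E} (φ : Z ⟶ G.obj N) {M M' : C} (f : M ⟶ M')
    (i : ℤ) (x : (singleFunctor C 0).obj N ⟶ ((singleFunctor C 0).obj M)⟦i⟧) :
    derivedMap K G φ M' i (x ≫ ((singleFunctor C 0).map f)⟦i⟧') =
      derivedMap K G φ M i x ≫ ((singleFunctor E 0).map (G.map f))⟦i⟧' := by
  have h := (G.mapDerivedCategorySingleFunctor 0).hom.naturality f
  dsimp at h
  simp only [derivedMap, LinearMap.coe_mk, AddHom.coe_mk, ShiftedHom.map, Functor.map_comp,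
    Category.assoc]
  rw [← Functor.map_comp, ← h, Functor.map_comp]
  simp

/-- Meant for G = Hom_K(N, -), G' = Hom_K(N', -) and τ precomposition with f: a change of N also
changes the functor, so naturality in N takes the form of the dinaturality condition `hφ`. -/
lemma derivedMap_naturality_left [HasExt.{w} C] [HasExt.{w'} E] [EnoughProjectives C]
    (G' : C ⥤ E) [G'.Additive] [PreservesFiniteLimits G'] [PreservesFiniteColimits G'] [G'.Linear K]
    (τ : G' ⟶ G) {N N' : C} {Z : E} (φ : Z ⟶ G.obj N) (φ' : Z ⟶ G'.obj N') (f : N ⟶ N')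
    (hφ : φ ≫ G.map f = φ' ≫ τ.app N') (M : C)
    (i : ℤ) (x : (singleFunctor C 0).obj N' ⟶ ((singleFunctor C 0).obj M)⟦i⟧) :
    derivedMap K G φ M i ((singleFunctor C 0).map f ≫ x) =
      derivedMap K G' φ' M i x ≫ ((singleFunctor E 0).map (τ.app M))⟦i⟧' := by
  by_cases hi : i < 0
  · exact (shiftedHom_single_eq_zero hi _).trans (shiftedHom_single_eq_zero hi _).symm
  · obtain ⟨n, rfl⟩ := Int.eq_ofNat_of_zero_le (not_lt.1 hi)
    obtain ⟨e, rfl⟩ := (Ext.homEquiv : Ext.{w} N' M n ≃ _).surjective x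
    change derivedMap K G φ M n ((singleFunctor C 0).map f ≫ e.hom) =
      derivedMap K G' φ' M n e.hom ≫ ((singleFunctor E 0).map (τ.app M))⟦(n : ℤ)⟧'
    have h₁ : (singleFunctor C 0).map f ≫ e.hom = ((Ext.mk₀ f).comp e (zero_add n)).hom := by
      rw [Ext.comp_hom, Ext.mk₀_hom]
      exact (ShiftedHom.mk₀_comp 0 rfl _ _).symm
    have h₂ (y : Ext.{w'} Z (G'.obj M) n) : y.hom ≫ ((singleFunctor E 0).map (τ.app M))⟦(n : ℤ)⟧' =
        (y.comp (Ext.mk₀ (τ.app M)) (add_zero n)).hom := by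
      rw [Ext.comp_hom, Ext.mk₀_hom]
      exact (ShiftedHom.comp_mk₀ _ 0 rfl _).symm
    rw [h₁, derivedMap_hom (E := E), derivedMap_hom (E := E), h₂, Ext.mapExactFunctor_comp,
      Ext.mapExactFunctor_mk₀, Ext.mk₀_comp_mk₀_assoc, hφ,
      Ext.comp_assoc_of_third_deg_zero, mapExactFunctor_naturality, Ext.mk₀_comp_mk₀_assoc]

end Derived

end ExactFunctors

/-! ### The bimodules of `K`-linear maps between modules -/

section HomBimodule

variable (K : Type v) [Field K] {A : Type u} [Ring A] [Algebra K A]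

lemma hom_map_ksmul {M N : ModuleCat.{u} A} (f : M ⟶ N) (c : K) (m : M) : f (c • m) = c • f m := by
  rw [← algebraMap_smul A c m, map_smul, algebraMap_smul]

/-- An `A`-linear map regarded as a `K`-linear map. -/
def homK {M N : ModuleCat.{u} A} (f : M ⟶ N) : M →ₗ[K] N where
  toFun := f
  map_add' := map_add f.hom
  map_smul' := hom_map_ksmul K f

/-- The left action of `A` on `Hom_K(N, M)`. -/
def homActionLeft (N M : ModuleCat.{u} A) : A →ₐ[K] Module.End K (N →ₗ[K] M) :=
  AlgHom.ofLinearMap ((LinearMap.llcomp K N M M) ∘ₗ (Algebra.lsmul K K M).toLinearMap)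
    (by ext; simp) (fun a b => by ext; simp)

/-- The right action of `A` on `Hom_K(N, M)`. -/
def homActionRight (N M : ModuleCat.{u} A) : Aᵐᵒᵖ →ₐ[K] Module.End K (N →ₗ[K] M) :=
  AlgHom.ofLinearMap ((LinearMap.llcomp K N N M).flip ∘ₗ (Algebra.lsmul K K N).toLinearMap ∘ₗ
    (MulOpposite.opLinearEquiv K).symm.toLinearMap)
    (by ext; simp) (fun a b => by ext; simp)

variable {K} in
lemma homAction_commute (N M : ModuleCat.{u} A) (a : A) (b : Aᵐᵒᵖ) :
    Commute (homActionLeft K N M a) (homActionRight K N M b) := by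
  ext
  simp [homActionLeft, homActionRight]

/-- The action of `A ⊗ Aᵒᵖ` on `Hom_K(N, M)`. -/
def homAction (N M : ModuleCat.{u} A) : Env K A →ₐ[K] Module.End K (N →ₗ[K] M) :=
  Algebra.TensorProduct.lift (homActionLeft K N M) (homActionRight K N M) (homAction_commute N M)

/-- The `A`-bimodule `Hom_K(N, M)`. -/
def homBimodule (N M : ModuleCat.{u} A) : ModuleCat.{u} (Env K A) :=
  letI : Module (Env K A) (N →ₗ[K] M) := Module.compHom _ (homAction K N M).toRingHom
  ModuleCat.of (Env K A) (N →ₗ[K] M)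

variable {K} in
/-- An element of `Hom_K(N, M)` as a linear map. -/
def toLin {N M : ModuleCat.{u} A} : homBimodule K N M ≃+ (N →ₗ[K] M) := AddEquiv.refl _

variable {K}

lemma toLin_smul {N M : ModuleCat.{u} A} (s : Env K A) (g : homBimodule K N M) :
    toLin (s • g) = homAction K N M s (toLin g) := rfl

lemma toLin_tmul_smul {N M : ModuleCat.{u} A} (x y : A) (g : homBimodule K N M) (n : N) :
    toLin ((x ⊗ₜ[K] MulOpposite.op y : Env K A) • g) n = x • toLin g (y • n) := by
  exact LinearMap.congr_fun (LinearMap.congr_fun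
    (Algebra.TensorProduct.lift_tmul _ _ (homAction_commute N M) x (MulOpposite.op y)) (toLin g)) n

lemma toLin_ksmul {N M : ModuleCat.{u} A} (c : K) (g : homBimodule K N M) :
    toLin (c • g) = c • toLin g := by
  rw [← algebraMap_smul (Env K A) c g, toLin_smul, AlgHom.commutes]
  rfl

lemma env_induction {p : Env K A → Prop} (h₀ : p 0) (h₁ : ∀ x y : A, p (x ⊗ₜ MulOpposite.op y))
    (h₂ : ∀ s t, p s → p t → p (s + t)) (s : Env K A) : p s :=
  TensorProduct.induction_on s h₀ (fun x y => h₁ x y.unop) h₂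

/-- A morphism of bimodules is an additive map compatible with pure tensors. -/
def bimoduleHom {X Y : ModuleCat.{u} (Env K A)} (f : X →+ Y)
    (h : ∀ (a b : A) (x : X), f ((a ⊗ₜ[K] MulOpposite.op b : Env K A) • x) =
      (a ⊗ₜ[K] MulOpposite.op b : Env K A) • f x) : X ⟶ Y :=
  ModuleCat.ofHom
    { toFun := f
      map_add' := map_add f
      map_smul' := fun s x => by
        induction s using env_induction with
        | h₀ =>
          exact (congrArg f (zero_smul (Env K A) x)).trans
            ((map_zero f).trans (zero_smul (Env K A) (f x)).symm)
        | h₁ a b => exact h a b x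
        | h₂ s t hs ht => rw [add_smul, map_add, hs, ht]; simp [add_smul] }

lemma homBimodule_ext {N M : ModuleCat.{u} A} {g g' : homBimodule K N M}
    (h : ∀ n, toLin g n = toLin g' n) : g = g' :=
  toLin.injective (LinearMap.ext h)

lemma homBimodule_hom_ext {X : ModuleCat.{u} (Env K A)} {N M : ModuleCat.{u} A}
    {φ ψ : X ⟶ homBimodule K N M} (h : ∀ x n, toLin (φ x) n = toLin (ψ x) n) : φ = ψ :=
  ModuleCat.hom_ext (LinearMap.ext fun x => homBimodule_ext (h x))

variable (K) in
/-- Post-composition with a morphism of modules. -/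
def homPost (N : ModuleCat.{u} A) {M M' : ModuleCat.{u} A} (f : M ⟶ M') :
    homBimodule K N M ⟶ homBimodule K N M' :=
  bimoduleHom
    (toLin.symm.toAddMonoidHom.comp
      (((LinearMap.llcomp K N _ _ (homK K f)).toAddMonoidHom).comp toLin.toAddMonoidHom))
    (fun a b g => homBimodule_ext fun n => by
      rw [toLin_tmul_smul]
      change f (toLin _ n) = a • f (toLin g (b • n))
      rw [toLin_tmul_smul]
      exact map_smul f.hom _ _)

variable (K) in
/-- Pre-composition with a morphism of modules. -/
def homPre {N N' : ModuleCat.{u} A} (f : N ⟶ N') (M : ModuleCat.{u} A) :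
    homBimodule K N' M ⟶ homBimodule K N M :=
  bimoduleHom
    (toLin.symm.toAddMonoidHom.comp
      ((((LinearMap.llcomp K N _ M).flip (homK K f)).toAddMonoidHom).comp toLin.toAddMonoidHom))
    (fun a b g => homBimodule_ext fun n => by
      rw [toLin_tmul_smul]
      change toLin ((a ⊗ₜ[K] MulOpposite.op b : Env K A) • g) (f n) = a • (toLin g (f (b • n)))
      rw [toLin_tmul_smul]
      exact congrArg (fun z => a • toLin g z) (map_smul f.hom _ _).symm)

variable (K) in
/-- The functor `M ↦ Hom_K(N, M)` from `A`-modules to `A`-bimodules. -/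
def homFunctor (N : ModuleCat.{u} A) : ModuleCat.{u} A ⥤ ModuleCat.{u} (Env K A) where
  obj M := homBimodule K N M
  map f := homPost K N f

instance (N : ModuleCat.{u} A) : (homFunctor (K := K) N).Additive where
  map_add {_ _ f g} := homBimodule_hom_ext (φ := homPost K N (f + g))
    (ψ := homPost K N f + homPost K N g) fun _ _ => rfl

lemma homPost_smul (N : ModuleCat.{u} A) {M M' : ModuleCat.{u} A} (c : K) (f : M ⟶ M') :
    homPost K N (c • f) = c • homPost K N f :=
  homBimodule_hom_ext fun x n => by
    change _ = toLin (c • (homPost K N f x)) n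
    rw [toLin_ksmul]
    rfl

instance (N : ModuleCat.{u} A) : (homFunctor K N).Linear K where
  map_smul f c := homPost_smul N c f

/-- Over a field N is projective, so a K-linear map into the range of f lifts through f. -/
lemma homPost_exact (N : ModuleCat.{u} A) {M₁ M₂ M₃ : ModuleCat.{u} A} (f : M₁ ⟶ M₂) (g : M₂ ⟶ M₃)
    (h : Function.Exact f g) : Function.Exact (homPost K N f) (homPost K N g) := by
  intro x
  constructor
  · intro hx
    have hx' (n : N) : toLin x n ∈ LinearMap.range (homK K f) :=
      (h _).1 (LinearMap.congr_fun (congrArg toLin hx) n)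
    obtain ⟨y, hy⟩ := Module.projective_lifting_property (homK K f).rangeRestrict
      (LinearMap.codRestrict _ (toLin x) hx') (LinearMap.surjective_rangeRestrict _)
    exact ⟨toLin.symm y, homBimodule_ext fun n => congrArg Subtype.val (LinearMap.congr_fun hy n)⟩
  · rintro ⟨y, rfl⟩
    exact homBimodule_ext fun n => (h _).2 ⟨_, rfl⟩

lemma homFunctor_map_exact (N : ModuleCat.{u} A) (T : ShortComplex (ModuleCat.{u} A))
    (h : T.Exact) : (T.map (homFunctor K N)).Exact := by
  rw [CategoryTheory.ShortComplex.ShortExact.moduleCat_exact_iff_function_exact] at h ⊢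
  exact homPost_exact N T.f T.g h

instance (N : ModuleCat.{u} A) : Limits.PreservesFiniteLimits (homFunctor K N) := by
  have := ((CategoryTheory.Functor.exact_tfae (homFunctor K N)).out 1 3).mp (homFunctor_map_exact N)
  exact this.1

instance (N : ModuleCat.{u} A) : Limits.PreservesFiniteColimits (homFunctor K N) := by
  have := ((CategoryTheory.Functor.exact_tfae (homFunctor K N)).out 1 3).mp (homFunctor_map_exact N)
  exact this.2

variable (K) in
/-- The contravariant functoriality of `Hom_K(N, M)` in `N`. -/
def homFunctorMap {N N' : ModuleCat.{u} A} (f : N ⟶ N') : homFunctor K N' ⟶ homFunctor K N where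
  app M := homPre K f M
  naturality _ _ g := homBimodule_hom_ext (φ := homPost K N' g ≫ homPre K f _)
    (ψ := homPre K f _ ≫ homPost K N g) fun _ _ => rfl

/-! ### The bimodule `A` -/

variable (K) in
/-- An element of `A` as an element of the bimodule `A`. -/
def toRegular : A ≃+ regularBimodule K A := AddEquiv.refl _

lemma tmul_smul_toRegular (x y a : A) :
    (x ⊗ₜ[K] MulOpposite.op y : Env K A) • toRegular K a = toRegular K (x * a * y) :=
  regularBimodule_smul K A x y a

variable (K) in
/-- The morphism of bimodules `A ⟶ Hom_K(N, N)` given by the action. -/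
def actionHom (N : ModuleCat.{u} A) : regularBimodule K A ⟶ homBimodule K N N :=
  bimoduleHom
    ((toLin.symm.toAddMonoidHom.comp
      (Algebra.lsmul K K N).toLinearMap.toAddMonoidHom).comp (toRegular K).symm.toAddMonoidHom)
    (fun a b x => homBimodule_ext fun n => by
      obtain ⟨x, rfl⟩ := (toRegular K).surjective x
      rw [toLin_tmul_smul, tmul_smul_toRegular]
      change (a * x * b) • n = a • x • b • n
      simp [mul_smul])

lemma toLin_hom_apply {X : ModuleCat.{u} (Env K A)} {N M : ModuleCat.{u} A}
    (φ : X ⟶ homBimodule K N M) (a b : A) (x : X) (n : N) :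
    toLin (φ ((a ⊗ₜ[K] MulOpposite.op b : Env K A) • x)) n = a • toLin (φ x) (b • n) :=
  (congrArg (fun g => toLin g n) (map_smul φ.hom _ x)).trans (toLin_tmul_smul a b _ n)

lemma toLin_toRegular_left {N M : ModuleCat.{u} A} (φ : regularBimodule K A ⟶ homBimodule K N M)
    (a : A) (n : N) :
    toLin (φ (toRegular K a)) n = a • toLin (φ (toRegular K 1)) n := by
  have h := toLin_hom_apply φ a 1 (toRegular K 1) n
  rwa [tmul_smul_toRegular, mul_one, mul_one, one_smul] at h

lemma toLin_toRegular_right {N M : ModuleCat.{u} A} (φ : regularBimodule K A ⟶ homBimodule K N M)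
    (a : A) (n : N) :
    toLin (φ (toRegular K a)) n = toLin (φ (toRegular K 1)) (a • n) := by
  have h := toLin_hom_apply φ 1 a (toRegular K 1) n
  rwa [tmul_smul_toRegular, mul_one, one_mul, one_smul] at h

/-- A bimodule map out of A is determined by the image of 1, and a·1 = 1·a says exactly that this
image is an A-linear map N → M. -/
lemma actionHom_bijective (N M : ModuleCat.{u} A) :
    Function.Bijective (fun f : N ⟶ M => actionHom K N ≫ homPost K N f) := by
  constructor
  · intro f f' h
    ext n
    have := LinearMap.congr_fun (congrArg toLin (ConcreteCategory.congr_hom h (toRegular K 1))) n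
    change f ((1 : A) • n) = f' ((1 : A) • n) at this
    rwa [one_smul] at this
  · intro φ
    refine ⟨ModuleCat.ofHom
      { toFun := toLin (φ (toRegular K 1))
        map_add' := map_add _
        map_smul' := fun a n =>
          (toLin_toRegular_right φ a n).symm.trans (toLin_toRegular_left φ a n) }, ?_⟩
    refine homBimodule_hom_ext fun x n => ?_
    obtain ⟨a, rfl⟩ := (toRegular K).surjective x
    exact (toLin_toRegular_right φ a n).symm

lemma actionHom_naturality {N N' : ModuleCat.{u} A} (f : N ⟶ N') :
    actionHom K N ≫ homPost K N f = actionHom K N' ≫ homPre K f N' :=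
  homBimodule_hom_ext fun x n => by
    obtain ⟨a, rfl⟩ := (toRegular K).surjective x
    exact map_smul f.hom a n

end HomBimodule

/-! ### Projectivity and restriction of scalars -/

section Restriction

/-- Restriction is left adjoint to coextension Hom_R(S, -), which preserves epimorphisms because S
is projective over R. -/
lemma projective_restrictScalars {R S : Type u} [Ring R] [Ring S] (f : R →+* S)
    (hS : Module.Projective R ((ModuleCat.restrictScalars.{u} f).obj (ModuleCat.of S S)))
    (P : ModuleCat.{u} S) [Projective P] :
    Projective ((ModuleCat.restrictScalars.{u} f).obj P) := by
  have : (ModuleCat.coextendScalars.{u, u, u} f).PreservesEpimorphisms := by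
    constructor
    intro M N g hg
    rw [ModuleCat.epi_iff_surjective] at hg ⊢
    intro y
    obtain ⟨x, hx⟩ := Module.projective_lifting_property g.hom
      (ModuleCat.CoextendScalars.equiv f N y) hg
    refine ⟨(ModuleCat.CoextendScalars.equiv f M).symm x, ?_⟩
    apply (ModuleCat.CoextendScalars.equiv f N).injective
    rw [← hx]
    rfl
  exact (ModuleCat.restrictCoextendScalarsAdj.{u, u, u} f).map_projective P inferInstance

variable (K : Type v) [Field K] (A : Type u) [Ring A] [Algebra K A]

/-- The enveloping algebra is free as a left `A`-module. -/
def envLeftEquiv : (A ⊗[K] Aᵐᵒᵖ) ≃ₗ[A]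
    (ModuleCat.restrictScalars.{u} (leftHom K A)).obj (ModuleCat.of (Env K A) (Env K A)) where
  __ := AddEquiv.refl (Env K A)
  map_smul' a s := by
    change a • s = leftHom K A a * s
    induction s using TensorProduct.induction_on with
    | zero => simp
    | tmul x y => simp [leftHom, TensorProduct.smul_tmul']
    | add x y hx hy => rw [smul_add, hx, hy, mul_add]

/-- The enveloping algebra is free as a left `Aᵒᵖ`-module. -/
def envRightEquiv : (Aᵐᵒᵖ ⊗[K] A) ≃ₗ[Aᵐᵒᵖ]
    (ModuleCat.restrictScalars.{u} (rightHom K A)).obj (ModuleCat.of (Env K A) (Env K A)) where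
  __ := (TensorProduct.comm K Aᵐᵒᵖ A).toAddEquiv
  map_smul' a s := by
    change TensorProduct.comm K Aᵐᵒᵖ A (a • s) = rightHom K A a * TensorProduct.comm K Aᵐᵒᵖ A s
    induction s using TensorProduct.induction_on with
    | zero => simp
    | tmul x y => simp [rightHom, TensorProduct.smul_tmul']
    | add x y hx hy => rw [smul_add, map_add, hx, hy, map_add, mul_add]

lemma projective_restrict_left (P : ModuleCat.{u} (Env K A)) [Projective P] :
    Projective ((ModuleCat.restrictScalars.{u} (leftHom K A)).obj P) :=
  projective_restrictScalars _ (Module.Projective.of_equiv (envLeftEquiv K A)) P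

lemma projective_restrict_right (P : ModuleCat.{u} (Env K A)) [Projective P] :
    Projective ((ModuleCat.restrictScalars.{u} (rightHom K A)).obj P) :=
  projective_restrictScalars _ (Module.Projective.of_equiv (envRightEquiv K A)) P

/-- `A` is projective as a right module over itself. -/
lemma projective_regular_right :
    Projective ((ModuleCat.restrictScalars.{u} (rightHom K A)).obj (regularBimodule K A)) := by
  have e : Aᵐᵒᵖ ≃ₗ[Aᵐᵒᵖ]
      (ModuleCat.restrictScalars.{u} (rightHom K A)).obj (regularBimodule K A) :=
    { __ := MulOpposite.opAddEquiv.symm.trans (toRegular K)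
      map_smul' := fun a b => by
        change toRegular K (a • b).unop =
          ((1 : A) ⊗ₜ[K] MulOpposite.op a.unop : Env K A) • toRegular K b.unop
        rw [tmul_smul_toRegular]
        simp }
  have := Module.Projective.of_equiv e
  exact (ModuleCat.of Aᵐᵒᵖ ((ModuleCat.restrictScalars.{u} (rightHom K A)).obj
    (regularBimodule K A))).projective_of_categoryTheory_projective

/-- The `A`-module of additive maps `A → I`, with `(a • w) b = w (b * a)`. -/
def coinducedModule {A : Type u} [Ring A] (I : ModuleCat.{u} A) : ModuleCat.{u} A :=
  @ModuleCat.of A _ (A →+ I) _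
    { smul := fun a w => w.comp (AddMonoidHom.mulRight a)
      one_smul := fun w => AddMonoidHom.ext fun b => congrArg w (mul_one b)
      mul_smul := fun a a' w => AddMonoidHom.ext fun b => congrArg w (mul_assoc b a a').symm
      smul_zero := fun _ => rfl
      smul_add := fun _ _ _ => rfl
      add_smul := fun a a' w => AddMonoidHom.ext fun b =>
        (congrArg w (mul_add b a a')).trans (map_add w _ _)
      zero_smul := fun w => AddMonoidHom.ext fun b => (congrArg w (mul_zero b)).trans (map_zero w) }

/-- Morphisms of bimodules to `Hom_K(N, I)`, with `I` injective, extend along monomorphisms which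
admit a retraction of right modules. -/
lemma exists_extension {X P : ModuleCat.{u} (Env K A)} (j : X ⟶ P) (r : P →+ X)
    (hr : ∀ (y : A) (p : P), r (((1 : A) ⊗ₜ[K] MulOpposite.op y : Env K A) • p) =
      ((1 : A) ⊗ₜ[K] MulOpposite.op y : Env K A) • r p)
    (hj : ∀ x, r (j x) = x) (N I : ModuleCat.{u} A) [Injective I] (g : X ⟶ homBimodule K N I) :
    ∃ g' : P ⟶ homBimodule K N I, j ≫ g' = g := by
  -- An injective I is a retract of the coinduced module, via m ↦ (b ↦ b m). Maps into the coinduced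
  -- module amount to additive maps into I, so a retraction that ignores the left action suffices
  -- there.
  let ι : I ⟶ coinducedModule I := ModuleCat.ofHom (Y := coinducedModule I)
    { toFun := fun m => (AddMonoidHom.smul : A →+ I →+ I).flip m
      map_add' := fun _ _ => map_add _ _ _
      map_smul' := fun a m => AddMonoidHom.ext fun b => (mul_smul b a m).symm }
  have : Mono ι := (ModuleCat.mono_iff_injective ι).2 fun m m' h => by
    have := DFunLike.congr_fun (show (AddMonoidHom.smul : A →+ I →+ I).flip m =
      (AddMonoidHom.smul : A →+ I →+ I).flip m' from h) 1
    change (1 : A) • m = (1 : A) • m' at this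
    simpa using this
  let ρ : coinducedModule I ⟶ I := Injective.factorThru (𝟙 I) ι
  have hρ (m : I) : ρ ((AddMonoidHom.smul : A →+ I →+ I).flip m) = m :=
    ConcreteCategory.congr_hom (Injective.comp_factorThru (𝟙 I) ι) m
  let L (a : A) : Env K A := a ⊗ₜ[K] MulOpposite.op 1
  -- The extension with coinduced values: b is absorbed into p before retracting, which restores
  -- left linearity. Right linearity of r gives compatibility with the action on N.
  let w (p : P) (n : N) : coinducedModule I := AddMonoidHom.mk'
    (fun b => toLin (g (r (L b • p))) n) fun b b' => by
      have : L (b + b') = L b + L b' := TensorProduct.add_tmul b b' _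
      rw [this, add_smul, map_add, map_add, map_add]
      rfl
  have hw₁ (p p' : P) (n : N) : w (p + p') n = w p n + w p' n := AddMonoidHom.ext fun b => by
    change toLin (g (r (L b • (p + p')))) n =
      toLin (g (r (L b • p))) n + toLin (g (r (L b • p'))) n
    rw [smul_add, map_add, map_add, map_add]
    rfl
  have hw₂ (p : P) (n n' : N) : w p (n + n') = w p n + w p n' :=
    AddMonoidHom.ext fun b => map_add (toLin (g (r (L b • p)))) n n'
  have hw₃ (c : K) (p : P) (n : N) : w p (c • n) = algebraMap K A c • w p n :=
      AddMonoidHom.ext fun b => by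
    change toLin (g (r (L b • p))) (c • n) = toLin (g (r (L (b * algebraMap K A c) • p))) n
    -- Scalars of K cross the tensor sign, so a left scalar can be traded for a right one and passed
    -- through r.
    have : L (b * algebraMap K A c) = (1 ⊗ₜ MulOpposite.op (algebraMap K A c) : Env K A) * L b := by
      simp only [L, Algebra.TensorProduct.tmul_mul_tmul, one_mul, ← MulOpposite.op_mul]
      rw [← Algebra.commutes, ← Algebra.smul_def, Algebra.algebraMap_eq_smul_one,
        MulOpposite.op_smul, TensorProduct.smul_tmul]
    rw [this, mul_smul, hr, toLin_hom_apply, one_smul, algebraMap_smul]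
  have hw₄ (a b : A) (p : P) (n : N) : w ((a ⊗ₜ[K] MulOpposite.op b : Env K A) • p) n =
      a • w p (b • n) := AddMonoidHom.ext fun x => by
    change toLin (g (r (L x • (a ⊗ₜ[K] MulOpposite.op b : Env K A) • p))) n =
      toLin (g (r (L (x * a) • p))) (b • n)
    have : L x * (a ⊗ₜ[K] MulOpposite.op b : Env K A) =
        (1 ⊗ₜ MulOpposite.op b : Env K A) * L (x * a) := by
      simp [L]
    rw [← mul_smul, this, mul_smul, hr, toLin_hom_apply, one_smul]
  let G (p : P) : N →ₗ[K] I :=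
    { toFun := fun n => ρ (w p n)
      map_add' := fun n n' => (congrArg ρ (hw₂ p n n')).trans (map_add ρ.hom _ _)
      map_smul' := fun c n => by
        rw [hw₃]
        exact (map_smul ρ.hom _ _).trans (algebraMap_smul A c _) }
  refine ⟨bimoduleHom (toLin.symm.toAddMonoidHom.comp
    { toFun := G
      map_zero' := LinearMap.ext fun n => ?_
      map_add' := fun p p' => LinearMap.ext fun n =>
        (congrArg ρ (hw₁ p p' n)).trans (map_add ρ.hom _ _) })
    fun a b p => homBimodule_ext fun n => ?_, homBimodule_hom_ext fun x n => ?_⟩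
  · have h := (congrArg ρ (hw₁ 0 0 n)).trans (map_add ρ.hom _ _)
    rw [add_zero] at h
    exact left_eq_add.1 h
  · rw [toLin_tmul_smul]
    exact (congrArg ρ (hw₄ a b p n)).trans (map_smul ρ.hom _ _)
  · refine Eq.trans (congrArg ρ (AddMonoidHom.ext fun b => ?_)) (hρ (toLin (g x) n))
    change toLin (g (r (L b • j x))) n = b • toLin (g x) n
    have h : L b • j x = j (L b • x) := (map_smul j.hom _ _).symm
    rw [h, hj, toLin_hom_apply, one_smul]

variable {K A} in
lemma nonempty_splitting_restrict_right {S : ShortComplex (ModuleCat.{u} (Env K A))}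
    (hS : S.ShortExact)
    (hX : Projective ((ModuleCat.restrictScalars.{u} (rightHom K A)).obj S.X₃)) :
    Nonempty (S.map (ModuleCat.restrictScalars.{u} (rightHom K A))).Splitting := by
  have hS' := hS.map_of_exact (ModuleCat.restrictScalars.{u} (rightHom K A))
  have := hS'.epi_g
  have : Projective (S.map (ModuleCat.restrictScalars.{u} (rightHom K A))).X₃ := hX
  exact ⟨ShortComplex.Splitting.ofExactOfSection _ hS'.exact (Projective.factorThru (𝟙 _) _)
    (Projective.factorThru_comp _ _) hS'.mono_f⟩

/-- `Hom_K(N, I)`, for `I` injective, is acyclic for bimodules which are projective on the right. -/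
lemma ext_homBimodule_eq_zero (N I : ModuleCat.{u} A) [Injective I] (n : ℕ)
    (X : ModuleCat.{u} (Env K A))
    (hX : Projective ((ModuleCat.restrictScalars.{u} (rightHom K A)).obj X))
    (e : Abelian.Ext.{u} X (homBimodule K N I) (n + 1)) : e = 0 := by
  induction n generalizing X with
  | zero =>
    let P : ProjectivePresentation X := Classical.arbitrary _
    let S := ShortComplex.mk _ _ (Limits.kernel.condition P.f)
    have hS : S.ShortExact := { exact := ShortComplex.exact_kernel P.f }
    have : Projective S.X₂ := P.projective
    -- Right projectivity of X splits the presentation as right modules. A degree 1 class comes from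
    -- a map on the kernel, which therefore extends to the projective, so the class is zero.
    obtain ⟨σ⟩ := nonempty_splitting_restrict_right hS hX
    obtain ⟨e', rfl⟩ := Abelian.Ext.contravariant_sequence_exact₃ hS _ e
      (Abelian.Ext.eq_zero_of_projective _) (add_comm 1 0)
    obtain ⟨g, rfl⟩ := (Abelian.Ext.mk₀_bijective _ _).2 e'
    obtain ⟨g', rfl⟩ := exists_extension K A S.f σ.r.hom.toAddMonoidHom
      (fun y p => σ.r.hom.map_smul (MulOpposite.op y) p)
      (fun x => ConcreteCategory.congr_hom σ.f_r x) N I g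
    rw [← Abelian.Ext.mk₀_comp_mk₀, hS.extClass_comp_assoc]
  | succ n hn =>
    let P : ProjectivePresentation X := Classical.arbitrary _
    let S := ShortComplex.mk _ _ (Limits.kernel.condition P.f)
    have hS : S.ShortExact := { exact := ShortComplex.exact_kernel P.f }
    have : Projective S.X₂ := P.projective
    obtain ⟨σ⟩ := nonempty_splitting_restrict_right hS hX
    obtain ⟨e', rfl⟩ := Abelian.Ext.contravariant_sequence_exact₃ hS _ e
      (Abelian.Ext.eq_zero_of_projective _) (add_comm 1 (n + 1))
    have : Projective (S.map (ModuleCat.restrictScalars.{u} (rightHom K A))).X₂ :=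
      projective_restrict_right K A S.X₂
    -- The kernel is a direct summand on the right of a right-projective module, so the induction
    -- hypothesis applies to it.
    have hX' : Projective (S.map (ModuleCat.restrictScalars.{u} (rightHom K A))).X₁ :=
      Retract.projective { i := _, r := σ.r, retract := σ.f_r }
    rw [hn S.X₁ hX' e', Abelian.Ext.comp_zero]

/-! ### Comparison of extensions of modules and of bimodules -/

/-- The map `Ext^i_A(N, M) → Ext^i_{Aᵉ}(A, Hom_K(N, M))`. -/
def extCompare (N M : ModuleCat.{u} A) (i : ℤ) :
    ExtZ N M i →ₗ[K] ExtZ (regularBimodule K A) (homBimodule K N M) i :=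
  derivedMap K (homFunctor K N) (actionHom K N) M i

lemma extCompare_bijective (N M : ModuleCat.{u} A) (i : ℤ) :
    Function.Bijective (extCompare K A N M i) :=
  derivedMap_bijective K (homFunctor K N) (actionHom K N) (fun M => actionHom_bijective N M)
    (fun I _ n e => ext_homBimodule_eq_zero K A N I n _ (projective_regular_right K A) e) M i

lemma extCompare_naturality_right (N : ModuleCat.{u} A) {M M' : ModuleCat.{u} A} (f : M ⟶ M')
    (i : ℤ) (x : ExtZ N M i) :
    extCompare K A N M' i (extPost K N f i x) =
      extPost K (regularBimodule K A) (homPost K N f) i (extCompare K A N M i x) :=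
  derivedMap_naturality_right K (homFunctor K N) (actionHom K N) f i x

lemma extCompare_naturality_left {N N' : ModuleCat.{u} A} (f : N ⟶ N') (M : ModuleCat.{u} A)
    (i : ℤ) (x : ExtZ N' M i) :
    extCompare K A N M i (extPre K f M i x) =
      extPost K (regularBimodule K A) (homPre K f M) i (extCompare K A N' M i x) :=
  derivedMap_naturality_left K (homFunctor K N) (homFunctor K N') (homFunctorMap K f)
    (actionHom K N) (actionHom K N') f (actionHom_naturality f) M i x

/-- The global dimension of `A` is bounded by the projective dimension of the bimodule `A`. -/
lemma globalDimensionLE_of_bimodule (d : ℕ)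
    (h : HasProjectiveDimensionLE (regularBimodule K A) d) : GlobalDimensionLE A d := by
  intro N
  refine (hasProjectiveDimensionLT_iff.{u} N (d + 1)).2 fun i hi M e => ?_
  have h₁ := mk₀_comp_mapExactFunctor_bijective (homFunctor K N) (actionHom K N)
    (fun M => actionHom_bijective N M)
    (fun I _ n e => ext_homBimodule_eq_zero K A N I n _ (projective_regular_right K A) e) M i
  have : HasProjectiveDimensionLT (regularBimodule K A) (d + 1) := h
  -- The comparison map is injective and lands in a vanishing Ext group of the bimodule A.
  apply h₁.1
  exact (Abelian.Ext.eq_zero_of_hasProjectiveDimensionLT _ (d + 1) hi).trans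
    (Abelian.Ext.eq_zero_of_hasProjectiveDimensionLT _ (d + 1) hi).symm

end Restriction

/-! ### Morphisms from K-projective complexes to shifted stalk complexes -/

section Cocycles

open CochainComplex HomComplex DerivedCategory

universe w w' t

variable {C : Type w} [Category.{w'} C] [Abelian C] (K : Type t) [CommRing K] [Linear K C]

/-- The degree `p` cocycles of a complex with values in an object. -/
abbrev cocyclesTo (Z : CochainComplex C ℤ) (X : C) (p : ℤ) : Submodule K (Z.X p ⟶ X) :=
  LinearMap.ker (Linear.leftComp K X (Z.d (p - 1) p))

variable {K} in
/-- Post-composition of cocycles. -/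
def cocyclesTo.postcomp {Z : CochainComplex C ℤ} {X Y : C} (u : X ⟶ Y) (p : ℤ) :
    cocyclesTo K Z X p →ₗ[K] cocyclesTo K Z Y p :=
  (Linear.rightComp K _ u).restrict fun f hf => by
    have : Z.d (p - 1) p ≫ f = 0 := hf
    simp [reassoc_of% this]

variable {K} in
/-- The morphism in the derived category which is attached to a cocycle. -/
def ofCocycle (Z : CochainComplex C ℤ) (X : C) {p j : ℤ} (h : p + j = 0)
    (f : Z.X p ⟶ X) (hf : Z.d (p - 1) p ≫ f = 0) :
    Q.obj Z ⟶ ((DerivedCategory.singleFunctor C 0).obj X)⟦j⟧ :=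
  ShiftedHom.map (Cocycle.equivHomShift.symm (Cocycle.toSingleMk f h (p - 1) (by lia) hf)) Q ≫
    ((DerivedCategory.singleFunctorIsoCompQ C 0).inv.app X)⟦j⟧'

lemma ofCocycle_postcomp (Z : CochainComplex C ℤ) {X Y : C} (u : X ⟶ Y) {p j : ℤ} (h : p + j = 0)
    (f : Z.X p ⟶ X) (hf : Z.d (p - 1) p ≫ f = 0) :
    ofCocycle Z Y h (f ≫ u) (by simp [reassoc_of% hf]) =
      ofCocycle Z X h f hf ≫ ((DerivedCategory.singleFunctor C 0).map u)⟦j⟧' := by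
  rw [ofCocycle, ofCocycle, Cocycle.toSingleMk_postcomp f h (p - 1) (by lia) hf,
    Cocycle.equivHomShift_symm_postcomp,
    Category.assoc, ← Functor.map_comp, ← NatTrans.naturality, Functor.map_comp]
  simp [ShiftedHom.map]

lemma ofCocycle_add (Z : CochainComplex C ℤ) (X : C) {p j : ℤ} (h : p + j = 0)
    (f g : Z.X p ⟶ X) (hf : Z.d (p - 1) p ≫ f = 0) (hg : Z.d (p - 1) p ≫ g = 0) :
    ofCocycle Z X h (f + g) (by simp [hf, hg]) = ofCocycle Z X h f hf + ofCocycle Z X h g hg := by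
  rw [ofCocycle, Cocycle.toSingleMk_add _ _ _ _ _ hf hg]
  simp [ofCocycle, ShiftedHom.map]

lemma ofCocycle_smul (Z : CochainComplex C ℤ) (X : C) {p j : ℤ} (h : p + j = 0) (c : K)
    (f : Z.X p ⟶ X) (hf : Z.d (p - 1) p ≫ f = 0) :
    ofCocycle Z X h (c • f) (by simp [hf]) = c • ofCocycle Z X h f hf := by
  -- Scaling a cocycle is post-composition with c • 𝟙, so linearity is a case of naturality.
  have h' := ofCocycle_postcomp Z (c • 𝟙 X) h f hf
  simp only [Linear.comp_smul, Category.comp_id, Functor.map_smul] at h'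
  rw [h', (DerivedCategory.singleFunctor C 0).map_id, CategoryTheory.Functor.map_id,
    Category.comp_id]

/-- The map from cocycles to morphisms in the derived category. -/
def cocycleMap (Z : CochainComplex C ℤ) (X : C) {p j : ℤ} (h : p + j = 0) :
    cocyclesTo K Z X p →ₗ[K] (Q.obj Z ⟶ ((DerivedCategory.singleFunctor C 0).obj X)⟦j⟧) where
  toFun f := ofCocycle Z X h f f.2
  map_add' f g := ofCocycle_add Z X h f g f.2 g.2
  map_smul' c f := ofCocycle_smul K Z X h c f f.2

lemma cocycleMap_postcomp (Z : CochainComplex C ℤ) {X Y : C} (u : X ⟶ Y) {p j : ℤ} (h : p + j = 0)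
    (f : cocyclesTo K Z X p) :
    cocycleMap K Z Y h (cocyclesTo.postcomp u p f) =
      cocycleMap K Z X h f ≫ ((DerivedCategory.singleFunctor C 0).map u)⟦j⟧' :=
  ofCocycle_postcomp Z u h f f.2

/-- Factors the morphism through the homotopy category, where K-projectivity of the source
identifies homotopy classes with morphisms of the derived category. -/
lemma shiftedHom_map_Q (Z L : CochainComplex C ℤ) {j : ℤ} (x : Cocycle Z L j) :
    ShiftedHom.map (Cocycle.equivHomShift.symm x) Q =
      (quotientCompQhIso C).inv.app Z ≫ Qh.map (CohomologyClass.toHom (.mk x)) ≫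
        (quotientCompQhIso C).hom.app _ ≫ (Q.commShiftIso j).hom.app L := by
  rw [CohomologyClass.toHom_mk, quotientCompQhIso_hom_naturality_assoc]
  simp [ShiftedHom.map]

lemma cocycleMap_surjective (Z : CochainComplex C ℤ) [Z.IsKProjective] (X : C) {p j : ℤ}
    (h : p + j = 0) : Function.Surjective (cocycleMap K Z X h) := by
  intro y
  obtain ⟨g, hg⟩ := (IsKProjective.Qh_map_bijective Z _).2
    ((quotientCompQhIso C).hom.app Z ≫
      y ≫ ((DerivedCategory.singleFunctorIsoCompQ C 0).hom.app X)⟦j⟧' ≫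
      (Q.commShiftIso j).inv.app _ ≫ (quotientCompQhIso C).inv.app _)
  obtain ⟨x, rfl⟩ := (CohomologyClass.toHom_bijective _ _ _).2 g
  obtain ⟨x, rfl⟩ := x.mk_surjective
  obtain ⟨f, hf, rfl⟩ := Cocycle.toSingleMk_surjective x p h (p - 1) (by lia)
  refine ⟨⟨f, hf⟩, ?_⟩
  change ShiftedHom.map (Cocycle.equivHomShift.symm
    (Cocycle.toSingleMk f h (p - 1) (by lia) hf)) Q ≫ _ = _
  rw [shiftedHom_map_Q, hg]
  simp [← Functor.map_comp]

/-- With surjectivity, this presents Hom(Z, X[j]) as cocycles modulo coboundaries when Z is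
K-projective, so that duality becomes linear algebra on Hom(Z^p, X). -/
lemma cocycleMap_eq_zero_iff (Z : CochainComplex C ℤ) [Z.IsKProjective] (X : C) {p j : ℤ}
    (h : p + j = 0) (f : cocyclesTo K Z X p) :
    cocycleMap K Z X h f = 0 ↔ ∃ g : Z.X (p + 1) ⟶ X, Z.d p (p + 1) ≫ g = f := by
  rw [← Cocycle.toSingleMk_mem_coboundaries_iff (f : Z.X p ⟶ X) h (p - 1) (by lia) f.2 (p + 1) rfl,
    ← CohomologyClass.toHom_mk_eq_zero_iff,
    ← (IsKProjective.Qh_map_bijective Z _).1.eq_iff (b := 0)]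
  change ShiftedHom.map (Cocycle.equivHomShift.symm
    (Cocycle.toSingleMk (f : Z.X p ⟶ X) h (p - 1) (by lia) _)) Q ≫ _ = _ ↔ _
  rw [shiftedHom_map_Q]
  constructor
  · intro h
    simpa using h
  · intro h
    rw [h]
    simp

end Cocycles

/-! ### Contravariant functors applied to unbounded complexes -/

section DualComplex

open Opposite CochainComplex

universe w w' t t'

variable {C : Type w} [Category.{w'} C] [Preadditive C] {E : Type t} [Category.{t'} E]
  [Preadditive E] (F : Cᵒᵖ ⥤ E) [F.Additive]

/-- The complex obtained by applying a contravariant functor to a complex indexed by `ℤ`. -/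
@[simps]
abbrev contraMap (L : CochainComplex C ℤ) : CochainComplex E ℤ where
  X n := F.obj (op (L.X (-n)))
  d i j := F.map (L.d (-j) (-i)).op
  shape i j hij := by
    rw [L.shape _ _ (fun h => hij (by simp at h ⊢; lia))]
    simp
  d_comp_d' i j k _ _ := by
    rw [← F.map_comp, ← op_comp, L.d_comp_d]
    simp

/-- The functoriality of `contraMap`. -/
@[simps]
abbrev contraMapHom {L L' : CochainComplex C ℤ} (f : L ⟶ L') : contraMap F L' ⟶ contraMap F L where
  f n := F.map (f.f (-n)).op
  comm' i j _ := by
    rw [← F.map_comp, ← F.map_comp, ← op_comp, ← op_comp, f.comm]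

lemma contraMapHom_comp {L L' L'' : CochainComplex C ℤ} (f : L ⟶ L') (g : L' ⟶ L'') :
    contraMapHom F (f ≫ g) = contraMapHom F g ≫ contraMapHom F f := by
  ext n
  simp

lemma contraMapHom_id (L : CochainComplex C ℤ) : contraMapHom F (𝟙 L) = 𝟙 _ := by
  ext n
  simp

/-- Homotopic morphisms stay homotopic. -/
def contraMapHomotopy {L L' : CochainComplex C ℤ} {f g : L ⟶ L'} (h : Homotopy f g) :
    Homotopy (contraMapHom F f) (contraMapHom F g) where
  hom i j := F.map (h.hom (-j) (-i)).op
  zero i j hij := by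
    rw [h.zero _ _ (fun h' => hij (by simp at h' ⊢; lia))]
    simp
  comm i := by
    have := h.comm (-i)
    rw [dNext_eq h.hom (show (ComplexShape.up ℤ).Rel (-i) (-(i - 1)) by simp; lia),
      prevD_eq h.hom (show (ComplexShape.up ℤ).Rel (-(i + 1)) (-i) by simp)] at this
    rw [dNext_eq _ (show (ComplexShape.up ℤ).Rel i (i + 1) by simp),
      prevD_eq _ (show (ComplexShape.up ℤ).Rel (i - 1) i by simp)]
    simp only [this, op_add, op_comp, F.map_add, F.map_comp]
    abel

/-- Homotopy equivalent complexes are sent to homotopy equivalent complexes. -/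
def contraMapHomotopyEquiv {L L' : CochainComplex C ℤ} (e : HomotopyEquiv L L') :
    HomotopyEquiv (contraMap F L') (contraMap F L) where
  hom := contraMapHom F e.hom
  inv := contraMapHom F e.inv
  homotopyHomInvId := (Homotopy.ofEq (contraMapHom_comp F _ _).symm).trans
    ((contraMapHomotopy F e.homotopyInvHomId).trans (.ofEq (contraMapHom_id F _)))
  homotopyInvHomId := (Homotopy.ofEq (contraMapHom_comp F _ _).symm).trans
    ((contraMapHomotopy F e.homotopyHomInvId).trans (.ofEq (contraMapHom_id F _)))

variable [Limits.HasZeroObject C] [Limits.HasZeroObject E]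

omit [Limits.HasZeroObject E] in
lemma contraMap_extend_isZero (P : ChainComplex C ℕ) (n : ℕ) :
    Limits.IsZero ((contraMap F (P.extend ComplexShape.embeddingDownNat)).X (Int.negSucc n)) := by
  refine Functor.map_isZero F (Limits.IsZero.op ?_)
  exact HomologicalComplex.isZero_extend_X _ _ _ (fun i h => by
    simp [Int.negSucc_eq] at h; lia)

/-- The complex obtained by applying a contravariant functor to a chain complex. -/
def contraMapNat (P : ChainComplex C ℕ) : CochainComplex E ℕ :=
  ((F.rightOp.mapHomologicalComplex _).obj P).unop

omit [Preadditive C] [Preadditive E] [F.Additive] [Limits.HasZeroObject C]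
  [Limits.HasZeroObject E] in
lemma map_conj_op {M₁ M₂ : E} {p₁ p₂ q₁ q₂ : C} (a₁ : M₁ ≅ F.obj (op p₁)) (a₂ : M₂ ≅ F.obj (op p₂))
    (b₁ : q₁ ≅ p₁) (b₂ : q₂ ≅ p₂) (d : p₂ ⟶ p₁) :
    (a₁ ≪≫ F.mapIso b₁.op).hom ≫ F.map (b₂.hom ≫ d ≫ b₁.inv).op =
      (a₁.hom ≫ F.map d.op ≫ a₂.inv) ≫ (a₂ ≪≫ F.mapIso b₂.op).hom := by
  simp [← F.map_comp, ← op_comp]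

/-- Extending a dual complex is the same as dualizing the extended complex. -/
def extendContraMapIso (P : ChainComplex C ℕ) :
    (contraMapNat F P).extend ComplexShape.embeddingUpNat ≅
      contraMap F (P.extend ComplexShape.embeddingDownNat) :=
  HomologicalComplex.Hom.isoOfComponents
    (fun n => match n with
      | .ofNat k => HomologicalComplex.extendXIso (contraMapNat F P) ComplexShape.embeddingUpNat
            (i := k) rfl ≪≫
          F.mapIso (HomologicalComplex.extendXIso P ComplexShape.embeddingDownNat (i := k) rfl).op
      | .negSucc k => Limits.IsZero.iso
          (HomologicalComplex.isZero_extend_X _ _ _ (fun i h => by simp at h))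
          (contraMap_extend_isZero F P k))
    (by
      rintro (i | i) (j | j) hij
      · have h₁ := HomologicalComplex.extend_d_eq (contraMapNat F P) ComplexShape.embeddingUpNat
          (i := i) (j := j) (i' := .ofNat i) (j' := .ofNat j) rfl rfl
        have h₂ := HomologicalComplex.extend_d_eq P ComplexShape.embeddingDownNat
          (i := j) (j := i) (i' := -.ofNat j) (j' := -.ofNat i) rfl rfl
        dsimp only
        rw [h₁]
        refine Eq.trans (congrArg (fun φ => _ ≫ F.map φ.op) h₂) ?_
        exact map_conj_op F _ _ _ _ _
      · exact (contraMap_extend_isZero F P j).eq_of_tgt _ _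
      · exact (HomologicalComplex.isZero_extend_X _ _ _
          (fun i h => by simp at h)).eq_of_src _ _
      · exact (contraMap_extend_isZero F P j).eq_of_tgt _ _)

end DualComplex

/-! ### Uniqueness of K-projective representatives up to homotopy. -/

section KProjective

open CochainComplex DerivedCategory

universe w w'

variable {C : Type w} [Category.{w'} C] [Abelian C]

/-- K-projective complexes which are isomorphic in the derived category are homotopy equivalent. -/
lemma nonempty_homotopyEquiv (Z Z' : CochainComplex C ℤ) [Z.IsKProjective] [Z'.IsKProjective]
    (e : Q.obj Z ≅ Q.obj Z') : Nonempty (HomotopyEquiv Z Z') := by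
  let e' := (quotientCompQhIso C).app Z ≪≫ e ≪≫ ((quotientCompQhIso C).app Z').symm
  obtain ⟨f, hf⟩ := (IsKProjective.Qh_map_bijective Z _).2 e'.hom
  obtain ⟨g, hg⟩ := (IsKProjective.Qh_map_bijective Z' _).2 e'.inv
  refine ⟨HomotopyCategory.homotopyEquivOfIso ⟨f, g, (IsKProjective.Qh_map_bijective Z _).1 ?_,
    (IsKProjective.Qh_map_bijective Z' _).1 ?_⟩⟩
  · rw [Functor.map_comp, hf, hg, e'.hom_inv_id, CategoryTheory.Functor.map_id]
    rfl
  · rw [Functor.map_comp, hf, hg, e'.inv_hom_id, CategoryTheory.Functor.map_id]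
    rfl

end KProjective

/-! ### Computing Ω_A from any K-projective representative of A. -/

section InverseDualizing

open Opposite DerivedCategory

variable (K : Type v) [Field K] (A : Type u) [Ring A] [Algebra K A]

/-- An additive contravariant functor need not respect quasi-isomorphisms, but it respects homotopy
equivalences; L and the chosen projective resolution are homotopy equivalent since both are
K-projective. -/
lemma nonempty_inverseDualizing_iso (L : CochainComplex (ModuleCat.{u} (Env K A)) ℤ)
    [L.IsKProjective] (e : stalk (regularBimodule K A) ≅ Q.obj L) :
    Nonempty (inverseDualizing K A ≅ Q.obj (contraMap (bimoduleDual K A) L)) := by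
  let P := projectiveResolution (regularBimodule K A)
  have : IsIso (Q.map P.π') := inferInstance
  obtain ⟨h⟩ := nonempty_homotopyEquiv P.cochainComplex L
    (asIso (Q.map P.π') ≪≫ ((singleFunctorIsoCompQ _ 0).symm.app _) ≪≫ e)
  let h' := contraMapHomotopyEquiv (bimoduleDual K A) h
  have : QuasiIso h'.hom := h'.quasiIso_hom
  exact ⟨Q.mapIso (extendContraMapIso (bimoduleDual K A) P.complex) ≪≫
    (asIso (Q.map h'.hom)).symm⟩

end InverseDualizing

/-! ### Duals of finitely generated projective bimodules -/

section Dual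

open Opposite

lemma exists_dualBasis (R : Type*) [Ring R] (P : Type*) [AddCommGroup P] [Module R P]
    [Module.Finite R P] [Module.Projective R P] :
    ∃ (n : ℕ) (p : Fin n → P) (φ : Fin n → P →ₗ[R] R), ∀ m, ∑ i, φ i m • p i = m := by
  obtain ⟨n, f, hf⟩ := Module.Finite.exists_fin' R P
  obtain ⟨s, hs⟩ := Module.projective_lifting_property f LinearMap.id hf
  refine ⟨n, fun i => f (Pi.single i 1), fun i => LinearMap.proj i ∘ₗ s, fun m => ?_⟩
  have h : s m = ∑ i, s m i • (Pi.single i 1 : Fin n → R) := by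
    ext j
    simp [Pi.single_apply]
  calc _ = f (∑ i, s m i • (Pi.single i 1 : Fin n → R)) := by simp
    _ = f (s m) := by rw [← h]
    _ = m := LinearMap.congr_fun hs m

variable (K : Type v) [Field K] (A : Type u) [Ring A] [Algebra K A]

/-- The inverse of the flip, as a map `Aᵉ → Aᵉ`. -/
def flip (s : Env K A) : Env K A := (envFlip K A s).unop

lemma exists_flip_eq (s : Env K A) : ∃ t, flip K A t = s :=
  ⟨(envFlip K A).symm (MulOpposite.op s), by simp [flip]⟩

variable {K A}

/-- An element of the dual of a bimodule, as a linear map. -/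
def dualEquiv (M : ModuleCat.{u} (Env K A)) :
    (bimoduleDual K A).obj (op M) ≃+ (M →ₗ[Env K A] Env K A) :=
  AddEquiv.refl _

lemma dualEquiv_smul (M : ModuleCat.{u} (Env K A)) (s : Env K A)
    (φ : (bimoduleDual K A).obj (op M)) (m : M) :
    dualEquiv M (s • φ) m = dualEquiv M φ m * flip K A s := rfl

/-- Applying ψ to m = ∑ φ_i(m) p_i gives ψ(m) = ∑ φ_i(m) ψ(p_i): the φ_i generate the dual, with
coefficients ψ(p_i) moved to the left action by the flip. -/
lemma dualEquiv_dualBasis {M : ModuleCat.{u} (Env K A)} {n : ℕ} {p : Fin n → M}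
    {φ : Fin n → M →ₗ[Env K A] Env K A} (h : ∀ m, ∑ i, φ i m • p i = m)
    (ψ : (bimoduleDual K A).obj (op M)) {t : Fin n → Env K A}
    (ht : ∀ i, flip K A (t i) = dualEquiv M ψ (p i)) :
    ∑ i, t i • (dualEquiv M).symm (φ i) = ψ := by
  refine (dualEquiv M).injective (LinearMap.ext fun m => ?_)
  rw [map_sum, LinearMap.sum_apply]
  calc _ = ∑ i, φ i m * dualEquiv M ψ (p i) := by
        refine Finset.sum_congr rfl fun i _ => ?_
        rw [dualEquiv_smul, ht, AddEquiv.apply_symm_apply]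
    _ = dualEquiv M ψ (∑ i, φ i m • p i) := by simp
    _ = _ := by rw [h]

/-- The dual of a finitely generated projective bimodule is projective. -/
lemma projective_bimoduleDual (P : ModuleCat.{u} (Env K A)) [Module.Finite (Env K A) P]
    [Module.Projective (Env K A) P] :
    Module.Projective (Env K A) ((bimoduleDual K A).obj (op P)) := by
  obtain ⟨n, p, φ, h⟩ := exists_dualBasis (Env K A) P
  let s : (bimoduleDual K A).obj (op P) →ₗ[Env K A] (Fin n → Env K A) :=
    { toFun := fun ψ i => (envFlip K A).symm (MulOpposite.op (dualEquiv P ψ (p i)))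
      map_add' := fun ψ ψ' => by
        ext i
        simp
      map_smul' := fun t ψ => by
        ext i
        simp [dualEquiv_smul, flip] }
  let r : (Fin n → Env K A) →ₗ[Env K A] (bimoduleDual K A).obj (op P) :=
    Fintype.linearCombination (Env K A) fun i => (dualEquiv P).symm (φ i)
  refine Module.Projective.of_split s r (LinearMap.ext fun ψ => ?_)
  exact dualEquiv_dualBasis h ψ fun i => by simp [s, flip]

/-! ### Dual pairs of bimodules -/

/-- A perfect duality between `X` and `Y`: an isomorphism of bimodules `Y ≅ Hom_K(X, K)`. -/
structure DualPair (X Y : ModuleCat.{u} (Env K A)) where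
  /-- the isomorphism between `Y` and the dual of `X` -/
  equiv : Y ≃ₗ[K] Module.Dual K X
  equiv_smul (s : Env K A) (y : Y) (x : X) : equiv (s • y) x = equiv y (flip K A s • x)

lemma ksmul_comm {X : ModuleCat.{u} (Env K A)} (c : K) (s : Env K A) (x : X) :
    s • c • x = c • s • x := by
  rw [← algebraMap_smul (Env K A) c x, ← algebraMap_smul (Env K A) c (s • x), smul_smul, smul_smul,
    Algebra.commutes]

/-- For `φ : P → Aᵉ`, the map `x ↦ (m ↦ φ m • x)`. -/
def evalHom {P : ModuleCat.{u} (Env K A)} (X : ModuleCat.{u} (Env K A))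
    (φ : P →ₗ[Env K A] Env K A) : X →ₗ[K] (P ⟶ X) where
  toFun x := ModuleCat.ofHom (φ.smulRight x)
  map_add' x x' := by ext m; simp
  map_smul' c x := by
    ext m
    exact ksmul_comm c (φ m) x

namespace DualPair

variable {X Y : ModuleCat.{u} (Env K A)} (b : DualPair X Y)

/-- The map `Hom_K(Hom(P, X), K) → Hom(P^∨, Y)`. -/
def dualMap (P : ModuleCat.{u} (Env K A)) :
    Module.Dual K (P ⟶ X) →ₗ[K] ((bimoduleDual K A).obj (op P) ⟶ Y) where
  toFun θ := bimoduleHom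
    { toFun := fun φ => b.equiv.symm (θ ∘ₗ evalHom X (dualEquiv P φ))
      map_zero' := by
        rw [show θ ∘ₗ evalHom X (dualEquiv P 0) = 0 by
          ext x
          rw [LinearMap.comp_apply, show evalHom X (dualEquiv P 0) x = 0 by
            ext m
            exact zero_smul (Env K A) x]
          exact map_zero θ]
        exact map_zero b.equiv.symm
      map_add' := fun φ φ' => by
        rw [← map_add]
        congr 1
        ext x
        rw [LinearMap.add_apply, LinearMap.comp_apply, LinearMap.comp_apply, LinearMap.comp_apply,
          ← map_add]
        congr 1
        ext m
        change dualEquiv P (φ + φ') m • x = dualEquiv P φ m • x + dualEquiv P φ' m • x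
        rw [map_add, LinearMap.add_apply, add_smul] }
    (fun y z φ => b.equiv.injective <| LinearMap.ext fun x => by
      rw [b.equiv_smul]
      change b.equiv (b.equiv.symm (θ ∘ₗ evalHom X (dualEquiv P _))) x =
        b.equiv (b.equiv.symm (θ ∘ₗ evalHom X (dualEquiv P φ))) _
      rw [LinearEquiv.apply_symm_apply, LinearEquiv.apply_symm_apply, LinearMap.comp_apply,
        LinearMap.comp_apply]
      congr 1
      ext m
      change dualEquiv P (_ • φ) m • x = dualEquiv P φ m • flip K A _ • x
      rw [dualEquiv_smul, smul_smul])
  map_add' θ θ' := by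
    ext φ
    exact (congrArg b.equiv.symm (LinearMap.add_comp _ _ _)).trans (map_add b.equiv.symm _ _)
  map_smul' c θ := by
    ext φ
    exact (congrArg b.equiv.symm (LinearMap.smul_comp _ _ _)).trans (map_smul b.equiv.symm _ _)

lemma equiv_dualMap (P : ModuleCat.{u} (Env K A)) (θ : Module.Dual K (P ⟶ X))
    (φ : (bimoduleDual K A).obj (op P)) (x : X) :
    b.equiv (b.dualMap P θ φ) x = θ (evalHom X (dualEquiv P φ) x) :=
  LinearMap.congr_fun (b.equiv.apply_symm_apply (θ ∘ₗ evalHom X (dualEquiv P φ))) x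

lemma hom_ext {Z : ModuleCat.{u} (Env K A)} {f g : Z ⟶ Y}
    (h : ∀ z x, b.equiv (f z) x = b.equiv (g z) x) : f = g :=
  ModuleCat.hom_ext (LinearMap.ext fun z => b.equiv.injective (LinearMap.ext (h z)))

lemma dualMap_precomp {P P' : ModuleCat.{u} (Env K A)} (a : P ⟶ P')
    (θ : Module.Dual K (P ⟶ X)) :
    b.dualMap P' (θ ∘ₗ Linear.leftComp K X a) =
      (bimoduleDual K A).map a.op ≫ b.dualMap P θ := by
  refine b.hom_ext fun φ x => ?_
  change _ = b.equiv (b.dualMap P θ ((bimoduleDual K A).map a.op φ)) x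
  rw [equiv_dualMap, equiv_dualMap]
  rfl

lemma dualMap_postcomp {X' Y' : ModuleCat.{u} (Env K A)} (b' : DualPair X' Y')
    (u : X ⟶ X') (w : Y' ⟶ Y) (h : ∀ y x, b.equiv (w y) x = b'.equiv y (u x))
    {P : ModuleCat.{u} (Env K A)} (θ : Module.Dual K (P ⟶ X')) :
    b.dualMap P (θ ∘ₗ Linear.rightComp K P u) = b'.dualMap P θ ≫ w := by
  refine b.hom_ext fun φ x => ?_
  change _ = b.equiv (w (b'.dualMap P θ φ)) x
  rw [h, equiv_dualMap, equiv_dualMap]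
  change θ _ = _
  congr 1
  ext m
  exact map_smul u.hom _ _

/-- By the dual basis, each f is the sum of the maps m ↦ φ_i(m) f(p_i). So θ is determined by its
values on such maps, and the inverse sends η to the form f ↦ ∑ ⟨η(φ_i), f(p_i)⟩. -/
lemma dualMap_bijective (P : ModuleCat.{u} (Env K A)) [Module.Finite (Env K A) P]
    [Module.Projective (Env K A) P] : Function.Bijective (b.dualMap P) := by
  obtain ⟨n, p, φ, h⟩ := exists_dualBasis (Env K A) P
  have hf (f : P ⟶ X) : ∑ i, evalHom X (φ i) (f (p i)) = f := by
    ext m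
    rw [ModuleCat.hom_sum, LinearMap.sum_apply]
    change ∑ i, φ i m • f.hom (p i) = f.hom m
    conv_rhs => rw [← h m]
    simp
  constructor
  · intro θ θ' hθ
    ext f
    rw [← hf f, map_sum, map_sum]
    refine Finset.sum_congr rfl fun i _ => ?_
    have h₁ := b.equiv_dualMap P θ ((dualEquiv P).symm (φ i)) (f (p i))
    have h₂ := b.equiv_dualMap P θ' ((dualEquiv P).symm (φ i)) (f (p i))
    rw [hθ] at h₁
    exact h₁.symm.trans h₂
  · intro η
    refine ⟨∑ i, b.equiv (η ((dualEquiv P).symm (φ i))) ∘ₗ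
      { toFun := fun f => f (p i)
        map_add' := fun _ _ => rfl
        map_smul' := fun _ _ => rfl }, b.hom_ext fun ψ x => ?_⟩
    rw [equiv_dualMap, LinearMap.sum_apply]
    choose t ht using fun i => exists_flip_eq K A (dualEquiv P ψ (p i))
    conv_rhs => rw [← dualEquiv_dualBasis h ψ ht]
    rw [map_sum, map_sum, LinearMap.sum_apply]
    refine Finset.sum_congr rfl fun i _ => ?_
    change b.equiv (η ((dualEquiv P).symm (φ i))) (dualEquiv P ψ (p i) • x) = _
    rw [← ht, ← b.equiv_smul]
    exact congrArg (fun z => b.equiv z x) (map_smul η.hom _ _).symm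

end DualPair

end Dual

/-! ### Duality for subquotients of vector spaces -/

section LinearAlgebra

variable {K : Type*} [Field K] {V H U H' : Type*} [AddCommGroup V] [Module K V]
  [AddCommGroup H] [Module K H] [AddCommGroup U] [Module K U] [AddCommGroup H'] [Module K H']

/-- If `H` is a quotient of `Z ⊆ V` and `H'` is a quotient of `Z' ⊆ U`, then an isomorphism
`V^* ≃ U` under which `Z'` corresponds to the forms that vanish on the kernel of `Z → H`, and the
kernel of `Z' → H'` to the forms that vanish on `Z`, induces an isomorphism `H^* ≃ H'`. -/
lemma exists_dual_subquotient_equiv (Z : Submodule K V) (γ : Z →ₗ[K] H)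
    (hγ : Function.Surjective γ) (Z' : Submodule K U) (γ' : Z' →ₗ[K] H')
    (hγ' : Function.Surjective γ') (l : Module.Dual K V →ₗ[K] U) (hl : Function.Bijective l)
    (h₁ : ∀ θ, l θ ∈ Z' ↔ ∀ z : Z, γ z = 0 → θ z = 0)
    (h₂ : ∀ (θ : Module.Dual K V) (h : l θ ∈ Z'), γ' ⟨l θ, h⟩ = 0 ↔ ∀ z : Z, θ z = 0) :
    ∃ E : Module.Dual K H ≃ₗ[K] H', ∀ (ξ : Module.Dual K H) (θ : Module.Dual K V)
      (h : l θ ∈ Z'), (∀ z : Z, θ z = ξ (γ z)) → E ξ = γ' ⟨l θ, h⟩ := by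
  -- The retraction extends the form ξ ∘ γ from Z to V. By `h₂` any other extension gives the same
  -- value, and this freedom is what makes naturality easy to check later.
  obtain ⟨r, hr⟩ := Z.subtype.exists_leftInverse_of_injective Z.ker_subtype
  have hr' (z : Z) : r z = z := LinearMap.congr_fun hr z
  have hmem (ξ : Module.Dual K H) : l (ξ ∘ₗ γ ∘ₗ r) ∈ Z' :=
    (h₁ _).2 fun z hz => by simp [hr', hz]
  let E₀ : Module.Dual K H →ₗ[K] H' := γ' ∘ₗ LinearMap.codRestrict Z'
    (l ∘ₗ LinearMap.lcomp K K (γ ∘ₗ r)) hmem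
  have hE (ξ : Module.Dual K H) (θ : Module.Dual K V) (h : l θ ∈ Z')
      (hθ : ∀ z : Z, θ z = ξ (γ z)) : E₀ ξ = γ' ⟨l θ, h⟩ := by
    have h' : l (ξ ∘ₗ γ ∘ₗ r - θ) ∈ Z' := by
      rw [map_sub]
      exact Z'.sub_mem (hmem ξ) h
    have := (h₂ _ h').2 fun z => by simp [hr', hθ]
    rw [← sub_eq_zero, ← this, show E₀ ξ = γ' ⟨_, hmem ξ⟩ from rfl, ← map_sub]
    congr 1
    ext
    simp
  refine ⟨LinearEquiv.ofBijective E₀ ⟨?_, ?_⟩, hE⟩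
  · rw [injective_iff_map_eq_zero]
    intro ξ hξ
    ext y
    obtain ⟨z, rfl⟩ := hγ y
    have := (h₂ _ (hmem ξ)).1 hξ z
    simpa [hr'] using this
  · intro y
    obtain ⟨⟨w, hw⟩, rfl⟩ := hγ' y
    obtain ⟨θ, rfl⟩ := hl.2 w
    have hker : LinearMap.ker γ ≤ LinearMap.ker (θ ∘ₗ Z.subtype) := fun z hz => (h₁ θ).1 hw z hz
    obtain ⟨s, hs⟩ := γ.exists_rightInverse_of_surjective (LinearMap.range_eq_top.2 hγ)
    refine ⟨θ ∘ₗ Z.subtype ∘ₗ s, hE _ θ hw fun z => ?_⟩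
    have : z - s (γ z) ∈ LinearMap.ker γ := by
      simp [show γ (s (γ z)) = γ z from LinearMap.congr_fun hs _]
    have := hker this
    simpa [sub_eq_zero] using this

end LinearAlgebra

/-! ### Duality for perfect complexes of bimodules -/

section Duality

open Opposite DerivedCategory

universe w w' t

/-- Lets the neighbouring index be any p' with p' + 1 = p, since dual complexes produce indices such
as `-(q + 1)`. -/
lemma mem_cocyclesTo_iff {C : Type w} [Category.{w'} C] [Abelian C] (K : Type t) [CommRing K]
    [Linear K C] {Z : CochainComplex C ℤ} {X : C} {p : ℤ} (p' : ℤ) (hp' : p' + 1 = p)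
    (f : Z.X p ⟶ X) : f ∈ cocyclesTo K Z X p ↔ Z.d p' p ≫ f = 0 := by
  obtain rfl : p' = p - 1 := by lia
  rfl

lemma cocycleMap_eq_zero_iff' {C : Type w} [Category.{w'} C] [Abelian C] (K : Type t) [CommRing K]
    [Linear K C] (Z : CochainComplex C ℤ) [Z.IsKProjective] (X : C) {p j : ℤ}
    (h : p + j = 0) (p'' : ℤ) (hp'' : p + 1 = p'') (f : cocyclesTo K Z X p) :
    cocycleMap K Z X h f = 0 ↔ ∃ g : Z.X p'' ⟶ X, Z.d p p'' ≫ g = f := by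
  subst hp''
  exact cocycleMap_eq_zero_iff K Z X h f

variable {K : Type v} [Field K] {A : Type u} [Ring A] [Algebra K A]

namespace DualPair

variable {X Y : ModuleCat.{u} (Env K A)} (b : DualPair X Y)
  (L : CochainComplex (ModuleCat.{u} (Env K A)) ℤ)
  [∀ n, Module.Finite (Env K A) (L.X n)] [∀ n, Module.Projective (Env K A) (L.X n)]
  [L.IsKProjective] [(contraMap (bimoduleDual K A) L).IsKProjective] (q : ℤ)

omit [∀ n, Module.Finite (Env K A) (L.X n)] [∀ n, Module.Projective (Env K A) (L.X n)]
  [L.IsKProjective] [(contraMap (bimoduleDual K A) L).IsKProjective] in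
lemma d_comp_dualMap (i j : ℤ) (θ : Module.Dual K (L.X (-j) ⟶ X)) :
    (contraMap (bimoduleDual K A) L).d i j ≫ b.dualMap _ θ =
      b.dualMap _ (θ ∘ₗ Linear.leftComp K X (L.d (-j) (-i))) :=
  (b.dualMap_precomp _ _).symm

omit [(contraMap (bimoduleDual K A) L).IsKProjective] in
-- The differential of the dual complex is the transpose of that of L, so closedness of the image of
-- θ means that θ vanishes on coboundaries.
lemma dualMap_mem_cocyclesTo_iff (θ : Module.Dual K (L.X (-q) ⟶ X)) :
    (b.dualMap _ θ : (contraMap (bimoduleDual K A) L).X q ⟶ Y) ∈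
        cocyclesTo K (contraMap (bimoduleDual K A) L) Y q ↔
      ∀ z : cocyclesTo K L X (-q), cocycleMap K L X (neg_add_cancel q) z = 0 → θ z = 0 := by
  rw [mem_cocyclesTo_iff K (q - 1) (by lia), d_comp_dualMap]
  refine (map_eq_zero_iff _ (b.dualMap_bijective (L.X (-(q - 1)))).1).trans ?_
  constructor
  · intro h z hz
    obtain ⟨g, hg⟩ := (cocycleMap_eq_zero_iff' K L X _ (-(q - 1)) (by lia) z).1 hz
    rw [← hg]
    exact LinearMap.congr_fun h g
  · intro h
    ext g
    exact h ⟨L.d (-q) (-(q - 1)) ≫ g, (mem_cocyclesTo_iff K (-q - 1) (by lia) _).2 (by simp)⟩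
      ((cocycleMap_eq_zero_iff' K L X _ (-(q - 1)) (by lia) _).2 ⟨g, rfl⟩)

omit [L.IsKProjective] in
lemma cocycleMap_dualMap_eq_zero_iff (θ : Module.Dual K (L.X (-q) ⟶ X))
    (h : (b.dualMap _ θ : (contraMap (bimoduleDual K A) L).X q ⟶ Y) ∈
        cocyclesTo K (contraMap (bimoduleDual K A) L) Y q) :
    cocycleMap K (contraMap (bimoduleDual K A) L) Y (add_neg_cancel q) ⟨_, h⟩ = 0 ↔
      ∀ z : cocyclesTo K L X (-q), θ z = 0 := by
  rw [cocycleMap_eq_zero_iff]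
  constructor
  · rintro ⟨g, hg⟩ z
    obtain ⟨θ', rfl⟩ := (b.dualMap_bijective (L.X (-(q + 1)))).2 g
    rw [d_comp_dualMap] at hg
    rw [← (b.dualMap_bijective (L.X (-q))).1 hg]
    refine (congrArg θ' ?_).trans (map_zero θ')
    exact (mem_cocyclesTo_iff K (-(q + 1)) (by lia) _).1 z.2
  · intro hθ
    have : θ ∈ (LinearMap.ker (Linear.leftComp K X (L.d (-(q + 1)) (-q)))).dualAnnihilator := by
      rw [Submodule.mem_dualAnnihilator]
      intro z hz
      exact hθ ⟨z, (mem_cocyclesTo_iff K (-(q + 1)) (by lia) _).2 hz⟩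
    -- Over a field a form vanishing on the kernel of a map factors through that map; the factor θ'
    -- provides the bounding cochain.
    rw [← LinearMap.range_dualMap_eq_dualAnnihilator_ker] at this
    obtain ⟨θ', rfl⟩ := this
    exact ⟨b.dualMap _ θ', b.d_comp_dualMap L q (q + 1) θ'⟩

lemma exists_duality :
    ∃ E : Module.Dual K (Q.obj L ⟶ (stalk X)⟦q⟧) ≃ₗ[K]
        (Q.obj (contraMap (bimoduleDual K A) L) ⟶ (stalk Y)⟦-q⟧),
      ∀ (ξ : Module.Dual K (Q.obj L ⟶ (stalk X)⟦q⟧)) (θ : Module.Dual K (L.X (-q) ⟶ X))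
        (h : (b.dualMap _ θ : (contraMap (bimoduleDual K A) L).X q ⟶ Y) ∈
          cocyclesTo K (contraMap (bimoduleDual K A) L) Y q),
        (∀ z : cocyclesTo K L X (-q), θ z = ξ (cocycleMap K L X (neg_add_cancel q) z)) →
        E ξ = cocycleMap K (contraMap (bimoduleDual K A) L) Y (add_neg_cancel q) ⟨_, h⟩ :=
  exists_dual_subquotient_equiv _ _ (cocycleMap_surjective K L X _) _ _
    (cocycleMap_surjective K (contraMap (bimoduleDual K A) L) Y (add_neg_cancel q))
    (b.dualMap _) (b.dualMap_bijective _) (b.dualMap_mem_cocyclesTo_iff L q)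
    (b.cocycleMap_dualMap_eq_zero_iff L q)

/-- The duality between morphisms from a perfect complex to shifts of `X`, and morphisms from the
dual complex to shifts of `Y`. -/
def duality : Module.Dual K (Q.obj L ⟶ (stalk X)⟦q⟧) ≃ₗ[K]
    (Q.obj (contraMap (bimoduleDual K A) L) ⟶ (stalk Y)⟦-q⟧) :=
  (b.exists_duality L q).choose

lemma duality_apply (ξ : Module.Dual K (Q.obj L ⟶ (stalk X)⟦q⟧))
    (θ : Module.Dual K (L.X (-q) ⟶ X))
    (h : (b.dualMap _ θ : (contraMap (bimoduleDual K A) L).X q ⟶ Y) ∈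
      cocyclesTo K (contraMap (bimoduleDual K A) L) Y q)
    (hθ : ∀ z : cocyclesTo K L X (-q), θ z = ξ (cocycleMap K L X (neg_add_cancel q) z)) :
    b.duality L q ξ =
      cocycleMap K (contraMap (bimoduleDual K A) L) Y (add_neg_cancel q) ⟨_, h⟩ :=
  (b.exists_duality L q).choose_spec ξ θ h hθ

lemma duality_naturality {X' Y' : ModuleCat.{u} (Env K A)} (b' : DualPair X' Y')
    (u : X ⟶ X') (w : Y' ⟶ Y) (huw : ∀ y x, b.equiv (w y) x = b'.equiv y (u x))
    (ξ : Module.Dual K (Q.obj L ⟶ (stalk X')⟦q⟧)) :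
    b.duality L q (ξ ∘ₗ Linear.rightComp K _ (((singleFunctor _ 0).map u)⟦q⟧')) =
      b'.duality L q ξ ≫ ((singleFunctor _ 0).map w)⟦-q⟧' := by
  -- A single extension θ computes both sides: θ itself for `b'`, and θ precomposed with the action
  -- of u for `b`.
  obtain ⟨θ, hθ⟩ := LinearMap.exists_extend (ξ ∘ₗ cocycleMap K L X' (neg_add_cancel q))
  have hθ' (z : cocyclesTo K L X' (-q)) : θ z = ξ (cocycleMap K L X' (neg_add_cancel q) z) :=
    LinearMap.congr_fun hθ z
  have hmem := (b'.dualMap_mem_cocyclesTo_iff L q θ).2 fun z hz => by rw [hθ', hz, map_zero]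
  have hmem' : (b.dualMap _ (θ ∘ₗ Linear.rightComp K _ u) :
      (contraMap (bimoduleDual K A) L).X q ⟶ Y) ∈
        cocyclesTo K (contraMap (bimoduleDual K A) L) Y q := by
    rw [dualMap_postcomp b b' u w huw]
    exact (cocyclesTo.postcomp w q ⟨_, hmem⟩).2
  rw [b'.duality_apply L q ξ θ hmem hθ', b.duality_apply L q _ _ hmem' fun z => ?_,
    ← cocycleMap_postcomp]
  · congr 1
    exact Subtype.ext (dualMap_postcomp b b' u w huw θ)
  · exact (hθ' (cocyclesTo.postcomp u (-q) z)).trans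
      (congrArg ξ (cocycleMap_postcomp K L u (neg_add_cancel q) z))

end DualPair

/-! ### The trace pairing -/

/-- The pairing `(g, f) ↦ tr (g f)` for `f : M → N` and `g : N → M`. -/
def tracePairing (M N : ModuleCat.{u} A) :
    homBimodule K N M →ₗ[K] Module.Dual K (homBimodule K M N) where
  toFun g :=
    { toFun := fun f => LinearMap.trace K M (toLin g ∘ₗ toLin f)
      map_add' := fun f f' => by simp [LinearMap.comp_add]
      map_smul' := fun c f => by simp [toLin_ksmul, LinearMap.comp_smul] }
  map_add' g g' := by
    ext f
    simp [LinearMap.add_comp]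
  map_smul' c g := by
    ext f
    simp [toLin_ksmul, LinearMap.smul_comp]

lemma tracePairing_apply (M N : ModuleCat.{u} A) (g : homBimodule K N M) (f : homBimodule K M N) :
    tracePairing M N g f = LinearMap.trace K M (toLin g ∘ₗ toLin f) := rfl

/-- Against a rank-one map the pairing is evaluation, and by `toLin_eq_sum` rank-one maps span
Hom_K(M, N) because M is finite-dimensional. -/
lemma tracePairing_smulRight (M N : ModuleCat.{u} A) [Module.Finite K M] (g : homBimodule K N M)
    (φ : M →ₗ[K] K) (n : N) :
    tracePairing M N g (toLin.symm (φ.smulRight n)) = φ (toLin g n) := by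
  rw [tracePairing_apply, AddEquiv.apply_symm_apply,
    show toLin g ∘ₗ φ.smulRight n = φ.smulRight (toLin g n) by ext; simp, LinearMap.trace_smulRight]

lemma toLin_eq_sum (M N : ModuleCat.{u} A) {ι : Type*} [Fintype ι]
    (b : Module.Basis ι K M) (f : homBimodule K M N) :
    ∑ i, toLin.symm ((b.coord i).smulRight (toLin f (b i))) = f := by
  apply toLin.injective
  rw [map_sum]
  refine b.ext fun j => ?_
  rw [LinearMap.sum_apply]
  classical
  simp [Finsupp.single_apply]

lemma tracePairing_bijective (M N : ModuleCat.{u} A) [Module.Finite K M] :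
    Function.Bijective (tracePairing (K := K) M N) := by
  constructor
  · rw [injective_iff_map_eq_zero]
    intro g hg
    refine homBimodule_ext fun n => ?_
    refine (Module.forall_dual_apply_eq_zero_iff K _).1 ?_
    intro φ
    rw [← tracePairing_smulRight, hg]
    rfl
  · intro ξ
    let b := Module.finBasis K M
    -- The preimage of ξ is forced by its values on rank-one maps: g(n) = ∑ ξ(b_i^* ⊗ n) b_i for a
    -- basis b of M.
    refine ⟨toLin.symm (∑ i, LinearMap.smulRight
      { toFun := fun n => ξ (toLin.symm ((b.coord i).smulRight n))
        map_add' := fun n n' => ?_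
        map_smul' := fun c n => ?_ } (b i)), ?_⟩
    · rw [← map_add, ← map_add]
      congr 2
      ext
      simp
    · rw [RingHom.id_apply, ← map_smul]
      congr 1
      apply toLin.injective
      rw [toLin_ksmul]
      ext
      simp [smul_comm c]
    · ext f
      conv_lhs => rw [← toLin_eq_sum M N b f]
      conv_rhs => rw [← toLin_eq_sum M N b f]
      rw [map_sum (tracePairing M N _), map_sum ξ]
      refine Finset.sum_congr rfl fun i _ => ?_
      rw [tracePairing_smulRight]
      simp [Finsupp.single_apply]

/-- The trace pairing puts `Hom_K(M, N)` and `Hom_K(N, M)` in duality. -/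
def traceDualPair (M N : ModuleCat.{u} A) [Module.Finite K M] :
    DualPair (homBimodule K M N) (homBimodule K N M) where
  equiv := LinearEquiv.ofBijective _ (tracePairing_bijective M N)
  equiv_smul s y x := by
    change tracePairing M N (s • y) x = tracePairing M N y (flip K A s • x)
    induction s using env_induction with
    | h₀ =>
      rw [show flip K A 0 = 0 by simp [flip], zero_smul (Env K A) y, zero_smul (Env K A) x,
        map_zero, map_zero]
      rfl
    | h₁ a b =>
      change _ = tracePairing M N y ((b ⊗ₜ[K] MulOpposite.op a : Env K A) • x)
      have h₁ : toLin ((a ⊗ₜ[K] MulOpposite.op b : Env K A) • y) ∘ₗ toLin x =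
          Algebra.lsmul K K M a ∘ₗ (toLin y ∘ₗ Algebra.lsmul K K N b ∘ₗ toLin x) :=
        LinearMap.ext fun m => toLin_tmul_smul a b y _
      have h₂ : toLin y ∘ₗ toLin ((b ⊗ₜ[K] MulOpposite.op a : Env K A) • x) =
          (toLin y ∘ₗ Algebra.lsmul K K N b ∘ₗ toLin x) ∘ₗ Algebra.lsmul K K M a :=
        LinearMap.ext fun m => congrArg (toLin y) (toLin_tmul_smul b a x _)
      rw [tracePairing_apply, tracePairing_apply, h₁, h₂]
      -- Cyclicity tr(a·ybx) = tr(ybx·a) turns the action of a ⊗ b on y into that of b ⊗ a on x.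
      exact LinearMap.trace_mul_comm K _ _
    | h₂ s t hs ht =>
      rw [add_smul, map_add, LinearMap.add_apply, hs, ht, ← map_add, ← add_smul]
      simp [flip]

lemma traceDualPair_equiv (M N : ModuleCat.{u} A) [Module.Finite K M] (g : homBimodule K N M)
    (f : homBimodule K M N) :
    (traceDualPair M N).equiv g f = LinearMap.trace K M (toLin g ∘ₗ toLin f) := rfl

lemma traceDualPair_homPost_homPre {M M' : ModuleCat.{u} A} (N : ModuleCat.{u} A)
    [Module.Finite K M] [Module.Finite K M'] (f : M ⟶ M') (y : homBimodule K N M)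
    (x : homBimodule K M' N) :
    (traceDualPair M' N).equiv (homPost K N f y) x =
      (traceDualPair M N).equiv y (homPre K f N x) := by
  rw [traceDualPair_equiv, traceDualPair_equiv]
  exact (LinearMap.trace_comp_comm' (homK K f) (toLin y ∘ₗ toLin x)).symm

lemma traceDualPair_homPre_homPost (M : ModuleCat.{u} A) {N N' : ModuleCat.{u} A}
    [Module.Finite K M] (g : N ⟶ N') (y : homBimodule K N' M) (x : homBimodule K M N) :
    (traceDualPair M N).equiv (homPre K g M y) x =
      (traceDualPair M N').equiv y (homPost K M g x) := rfl

end Duality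

/-! ### Bounded above complexes of projective objects -/

section Cone

open CochainComplex DerivedCategory Limits Pretriangulated

universe w w'

variable {C : Type w} [Category.{w'} C] [Abelian C]

lemma projective_mappingCone {L Z : CochainComplex C ℤ} (f : L ⟶ Z) [∀ n, Projective (L.X n)]
    [∀ n, Projective (Z.X n)] (n : ℤ) : Projective ((mappingCone f).X n) :=
  Projective.of_iso (HomologicalComplex.homotopyCofiber.XIsoBiprod f n (n + 1) rfl).symm
    inferInstance

lemma isStrictlyLE_mappingCone {L Z : CochainComplex C ℤ} (f : L ⟶ Z) (a : ℤ) [L.IsStrictlyLE a]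
    [Z.IsStrictlyLE a] : (mappingCone f).IsStrictlyLE a := by
  rw [isStrictlyLE_iff]
  intro n hn
  refine IsZero.of_iso ?_ (HomologicalComplex.homotopyCofiber.XIsoBiprod f n (n + 1) rfl)
  rw [biprod_isZero_iff]
  exact ⟨L.isZero_of_isStrictlyLE a (n + 1), Z.isZero_of_isStrictlyLE a n⟩

/-- The third object of a distinguished triangle is represented by a bounded above complex of
projective objects if the two other ones are. -/
lemma exists_projective_cone (T : Triangle (DerivedCategory C)) (hT : T ∈ distTriang _)
    (L Z : CochainComplex C ℤ) (a : ℤ) [L.IsStrictlyLE a] [Z.IsStrictlyLE a]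
    [∀ n, Projective (L.X n)] [∀ n, Projective (Z.X n)] (e₁ : T.obj₁ ≅ Q.obj L)
    (e₂ : T.obj₂ ≅ Q.obj Z) :
    ∃ W : CochainComplex C ℤ, W.IsStrictlyLE a ∧ (∀ n, Projective (W.X n)) ∧
      Nonempty (T.obj₃ ≅ Q.obj W) := by
  have := isKProjective_of_projective L a
  -- K-projectivity of L represents the first morphism by a chain map f. Its cone has terms L^{n+1}
  -- ⊕ Z^n, hence projective terms and the same upper bound.
  obtain ⟨f, hf⟩ := (IsKProjective.Qh_map_bijective L _).2 ((quotientCompQhIso C).hom.app L ≫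
    e₁.inv ≫ T.mor₁ ≫ e₂.hom ≫ (quotientCompQhIso C).inv.app Z)
  obtain ⟨f, rfl⟩ := (HomotopyCategory.quotient C _).map_surjective f
  have hf' : T.mor₁ ≫ e₂.hom = e₁.hom ≫ Q.map f := by
    rw [← cancel_mono ((quotientCompQhIso C).inv.app Z), Category.assoc, Category.assoc,
      quotientCompQhIso_inv_naturality, hf]
    simp
  refine ⟨mappingCone f, isStrictlyLE_mappingCone f a, projective_mappingCone f, ⟨?_⟩⟩
  exact Triangle.π₃.mapIso (isoTriangleOfIso₁₂ T _ hT (mappingCone_triangle_distinguished f) e₁ e₂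
    hf')

end Cone

/-! ### Morphisms to the bimodules `Hom_K(N, M)` -/

section Vanishing

open DerivedCategory

variable {K : Type v} [Field K] {A : Type u} [Ring A] [Algebra K A]

lemma isFinDimQuotientComplex_stalk (e : A) (M : ModuleCat.{u} A) (hM : IsFinDim K M)
    (hM' : IsQuotientModule e M) : IsFinDimQuotientComplex K e (stalk M) := by
  have h₀ : (homologyFunctor (ModuleCat.{u} A) 0).obj (stalk M) ≅ M :=
    (singleFunctorCompHomologyFunctorIso _ 0).app M
  have h₁ (n : ℤ) (hn : n ≠ 0) :
      Limits.IsZero ((homologyFunctor (ModuleCat.{u} A) n).obj (stalk M)) :=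
    (HomologicalComplex.isZero_single_obj_homology (ComplexShape.up ℤ) 0 M n hn).of_iso
      ((homologyFunctorFactors _ n).app _)
  have h₂ (n : ℤ) (hn : n ≠ 0) :
      Subsingleton ((homologyFunctor (ModuleCat.{u} A) n).obj (stalk M)) :=
    ModuleCat.subsingleton_of_isZero (h₁ n hn)
  refine ⟨fun n => ?_, fun n => ?_, (Set.finite_singleton (0 : ℤ)).subset fun n hn => ?_⟩
  · by_cases hn : n = 0
    · subst hn
      intro a ha m
      apply h₀.toLinearEquiv.injective
      rw [map_smul, map_zero, hM' a ha]
    · have := h₂ n hn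
      exact fun _ _ _ => Subsingleton.elim _ _
  · by_cases hn : n = 0
    · subst hn
      have : Module.Finite K M := hM
      exact Module.Finite.of_surjective (homK K h₀.inv) h₀.symm.toLinearEquiv.surjective
    · have := h₂ n hn
      exact Module.Finite.of_finite
  · by_contra h
    exact not_subsingleton_iff_nontrivial.2 hn (h₂ n h)

/-- The `A`-linear map `w ↦ z(w)(x)` for a bimodule homomorphism `z : W → Hom_K(N, M)`. -/
def evalAt {W : ModuleCat.{u} (Env K A)} {N M : ModuleCat.{u} A} (z : W ⟶ homBimodule K N M)
    (x : N) : (ModuleCat.restrictScalars.{u} (leftHom K A)).obj W ⟶ M :=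
  ModuleCat.ofHom (X := (ModuleCat.restrictScalars.{u} (leftHom K A)).obj W)
    { toFun := fun w => toLin (z w) x
      map_add' := fun w w' => by
        rw [show z (w + w') = z w + z w' from map_add z.hom w w', map_add, LinearMap.add_apply]
      map_smul' := fun a w => by
        have := toLin_hom_apply z a 1 w x
        rwa [one_smul] at this }

/-! ### Bimodule maps into Hom_K(F, M) for F free. -/

section Free

variable {W : ModuleCat.{u} (Env K A)} {ι : Type u} {M : ModuleCat.{u} A}
  (g : ι → ((ModuleCat.restrictScalars.{u} (leftHom K A)).obj W ⟶ M))

/-- An element of a bimodule, regarded as an element of the underlying left module. -/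
def toLeft : W ≃+ (ModuleCat.restrictScalars.{u} (leftHom K A)).obj W := AddEquiv.refl _

lemma map_toLeft (φ : (ModuleCat.restrictScalars.{u} (leftHom K A)).obj W ⟶ M) (a : A) (w : W) :
    φ (toLeft ((a ⊗ₜ[K] MulOpposite.op 1 : Env K A) • w)) = a • φ (toLeft w) :=
  map_smul φ.hom a _

/-- The maps compared below are only additive, so agreement on the basis vectors alone would not
suffice. -/
lemma addHom_ext_basis {F : ModuleCat.{u} A} (B : Module.Basis ι A F) {φ ψ : F →+ M}
    (h : ∀ (i : ι) (a : A), φ (a • B i) = ψ (a • B i)) : φ = ψ := by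
  have : φ.comp B.repr.symm.toLinearMap.toAddMonoidHom =
      ψ.comp B.repr.symm.toLinearMap.toAddMonoidHom :=
    Finsupp.addHom_ext fun i a => by simpa using h i a
  ext f
  simpa using DFunLike.congr_fun this (B.repr f)

variable {F : ModuleCat.{u} A} (B : Module.Basis ι A F)

/-- The additive map from a free module given by `f ↦ ∑ i, g i (w f_i)`. -/
def freeEval (w : W) : F →+ M :=
  (Finsupp.liftAddHom fun i =>
    { toFun := fun a => g i (toLeft ((1 ⊗ₜ[K] MulOpposite.op a : Env K A) • w))
      map_zero' := by
        rw [MulOpposite.op_zero, TensorProduct.tmul_zero, zero_smul (Env K A) w, map_zero]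
        exact map_zero (g i).hom
      map_add' := fun a b => by
        rw [MulOpposite.op_add, TensorProduct.tmul_add, add_smul, map_add]
        exact map_add (g i).hom _ _ }).comp B.repr.toLinearMap.toAddMonoidHom

lemma freeEval_smul_basis (w : W) (i : ι) (a : A) :
    freeEval g B w (a • B i) = g i (toLeft ((1 ⊗ₜ[K] MulOpposite.op a : Env K A) • w)) := by
  have h : B.repr (a • B i) = Finsupp.single i a := by simp
  exact (congrArg _ h).trans (Finsupp.liftAddHom_apply_single _ _ _)

lemma freeEval_add (w w' : W) : freeEval g B (w + w') = freeEval g B w + freeEval g B w' := by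
  refine addHom_ext_basis B fun i a => ?_
  rw [AddMonoidHom.add_apply, freeEval_smul_basis, freeEval_smul_basis, freeEval_smul_basis,
    smul_add, map_add]
  exact map_add (g i).hom _ _

lemma freeEval_tmul_smul (a b : A) (w : W) (f : F) :
    freeEval g B ((a ⊗ₜ[K] MulOpposite.op b : Env K A) • w) f = a • freeEval g B w (b • f) := by
  refine DFunLike.congr_fun (f := freeEval g B _)
    (g := (DistribSMul.toAddMonoidHom M a).comp ((freeEval g B w).comp
      (DistribSMul.toAddMonoidHom F b))) (addHom_ext_basis B fun i c => ?_) f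
  change _ = a • freeEval g B w (b • c • B i)
  rw [smul_smul, freeEval_smul_basis, freeEval_smul_basis, ← map_toLeft, smul_smul, smul_smul]
  congr 3
  simp [Algebra.TensorProduct.tmul_mul_tmul]

lemma freeEval_ksmul (c : K) (w : W) (f : F) :
    freeEval g B w (c • f) = c • freeEval g B w f := by
  have h₁ := freeEval_tmul_smul g B 1 (algebraMap K A c) w f
  have h₂ := freeEval_tmul_smul g B (algebraMap K A c) 1 w f
  rw [one_smul] at h₁ h₂
  rw [← algebraMap_smul A c f, ← algebraMap_smul A c (freeEval g B w f)]
  refine h₁.symm.trans (Eq.trans ?_ h₂)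
  rw [Algebra.algebraMap_eq_smul_one, MulOpposite.op_smul, TensorProduct.tmul_smul,
    TensorProduct.smul_tmul']

/-- A family of left linear maps defines a homomorphism to `Hom_K(F, M)` for `F` free. -/
def liftFree : W ⟶ homBimodule K F M :=
  bimoduleHom
    { toFun := fun w => toLin.symm
        { toFun := freeEval g B w
          map_add' := map_add (freeEval g B w)
          map_smul' := fun c f => freeEval_ksmul g B c w f }
      map_zero' := by
        have h : freeEval g B (0 : W) = 0 := by
          have := freeEval_add g B 0 0
          rwa [add_zero, left_eq_add] at this
        exact homBimodule_ext fun f => DFunLike.congr_fun h f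
      map_add' := fun w w' => homBimodule_ext fun f =>
        DFunLike.congr_fun (freeEval_add g B w w') f }
    (fun a b w => homBimodule_ext fun f => by
      rw [toLin_tmul_smul]
      exact freeEval_tmul_smul g B a b w f)

lemma liftFree_evalAt (z : W ⟶ homBimodule K F M) :
    liftFree (fun i => evalAt z (B i)) B = z := by
  refine homBimodule_hom_ext fun w f => ?_
  change freeEval _ B w f = (toLin (z w)).toAddMonoidHom f
  refine DFunLike.congr_fun (addHom_ext_basis B fun i a => ?_) f
  rw [freeEval_smul_basis]
  have := toLin_hom_apply z 1 a w (B i)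
  rwa [one_smul] at this

lemma comp_liftFree {W' : ModuleCat.{u} (Env K A)} (d : W' ⟶ W) :
    d ≫ liftFree g B =
      liftFree (fun i => (ModuleCat.restrictScalars.{u} (leftHom K A)).map d ≫ g i) B := by
  refine homBimodule_hom_ext fun w f => ?_
  change freeEval g B (d w) f = freeEval _ B w f
  refine DFunLike.congr_fun (addHom_ext_basis B fun i a => ?_) f
  rw [freeEval_smul_basis, freeEval_smul_basis]
  exact congrArg (fun x => g i (toLeft x)) (map_smul d.hom _ _).symm

end Free

/-- Every cocycle of `W` of degree `p` with values in `X` is a coboundary. -/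
def CocyclesBound {R : Type u} [Ring R] (W : CochainComplex (ModuleCat.{u} R) ℤ)
    (X : ModuleCat.{u} R) (p : ℤ) : Prop :=
  ∀ z : W.X p ⟶ X, W.d (p - 1) p ≫ z = 0 → ∃ g : W.X (p + 1) ⟶ X, W.d p (p + 1) ≫ g = z

variable (W : CochainComplex (ModuleCat.{u} (Env K A)) ℤ) (M : ModuleCat.{u} A)

/-- Evaluation at the basis vectors identifies Hom_{Aᵉ}(W, Hom_K(F, M)) with a product of copies of
Hom_A(W, M), naturally in W, so cocycles can be bounded one coordinate at a time. -/
lemma cocyclesBound_free {ι : Type u} {F : ModuleCat.{u} A} (B : Module.Basis ι A F) (p : ℤ)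
    (h : CocyclesBound (((ModuleCat.restrictScalars.{u} (leftHom K A)).mapHomologicalComplex
      (ComplexShape.up ℤ)).obj W) M p) :
    CocyclesBound W (homBimodule K F M) p := by
  intro z hz
  have h' (i : ι) : ∃ g : (ModuleCat.restrictScalars.{u} (leftHom K A)).obj (W.X (p + 1)) ⟶ M,
      (ModuleCat.restrictScalars.{u} (leftHom K A)).map (W.d p (p + 1)) ≫ g = evalAt z (B i) := by
    refine h (evalAt z (B i)) ?_
    ext w
    exact LinearMap.congr_fun (congrArg toLin (ConcreteCategory.congr_hom hz w)) _
  choose g hg using h'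
  refine ⟨liftFree g B, ?_⟩
  rw [comp_liftFree, funext hg, liftFree_evalAt]

/-- A piece of the long exact sequence of 0 → Hom_K(N, M) → Hom_K(F, M) → Hom_K(N', M) → 0, which
stays exact under Hom(W^n, -). Degree p + 1 enters because Hom is contravariant in W. -/
lemma cocyclesBound_step [∀ n, Projective (W.X n)] (p : ℤ) {N' F N : ModuleCat.{u} A}
    (j : N' ⟶ F) (q : F ⟶ N) (hj : Function.Injective j) (hjq' : Function.Exact j q)
    (hq : Function.Surjective q) (h : CocyclesBound W (homBimodule K F M) p)
    (h' : CocyclesBound W (homBimodule K N' M) (p + 1)) :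
    CocyclesBound W (homBimodule K N M) p := by
  intro z hz
  obtain ⟨r, hr⟩ := (homK K j).exists_leftInverse_of_injective (LinearMap.ker_eq_bot.2 hj)
  obtain ⟨s, hs⟩ := (homK K q).exists_rightInverse_of_surjective (LinearMap.range_eq_top.2 hq)
  have hs' (n : N) : q (s n) = n := LinearMap.congr_fun hs n
  have hjq (X : ModuleCat.{u} (Env K A)) (f : X ⟶ homBimodule K N M) :
      (f ≫ homPre K q M) ≫ homPre K j M = 0 := homBimodule_hom_ext fun x n => by
    change toLin (f x) (q (j n)) = 0
    rw [hjq'.apply_apply_eq_zero, map_zero]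
  have hmono (X : ModuleCat.{u} (Env K A)) (f f' : X ⟶ homBimodule K N M)
      (hf : f ≫ homPre K q M = f' ≫ homPre K q M) : f = f' := homBimodule_hom_ext fun x n => by
    obtain ⟨n, rfl⟩ := hq n
    exact LinearMap.congr_fun (congrArg toLin (ConcreteCategory.congr_hom hf x)) n
  have hepi : Epi (homPre K j M) := by
    rw [ModuleCat.epi_iff_surjective]
    exact fun x => ⟨toLin.symm (toLin x ∘ₗ r), homBimodule_ext fun n =>
      congrArg (toLin x) (LinearMap.congr_fun hr n)⟩
  have hlift (X : ModuleCat.{u} (Env K A)) (f : X ⟶ homBimodule K F M)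
      (hf : f ≫ homPre K j M = 0) : ∃ f' : X ⟶ homBimodule K N M, f' ≫ homPre K q M = f := by
    have hf' (x : X) (y y' : F) (hy : q y = q y') : toLin (f x) y = toLin (f x) y' := by
      obtain ⟨n, hn⟩ := (hjq' (y - y')).1 ((map_sub q.hom y y').trans (sub_eq_zero.2 hy))
      have := LinearMap.congr_fun (congrArg toLin (ConcreteCategory.congr_hom hf x)) n
      change toLin (f x) (j n) = 0 at this
      rwa [hn, map_sub, sub_eq_zero] at this
    refine ⟨bimoduleHom
      { toFun := fun x => toLin.symm (toLin (f x) ∘ₗ s)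
        map_zero' := homBimodule_ext fun n => by
          change toLin (f 0) (s n) = 0
          rw [show f 0 = 0 from map_zero f.hom]
          rfl
        map_add' := fun x y => homBimodule_ext fun n => by
          change toLin (f (x + y)) (s n) = toLin (f x) (s n) + toLin (f y) (s n)
          rw [show f (x + y) = f x + f y from map_add f.hom x y, map_add]
          rfl } (fun a b x => homBimodule_ext fun n => ?_),
      homBimodule_hom_ext fun x y => hf' x _ _ (hs' _)⟩
    rw [toLin_tmul_smul]
    change toLin (f _) (s n) = a • toLin (f x) (s (b • n))
    rw [toLin_hom_apply]
    -- The section s is only K-linear, but s(b n) and b s(n) differ by an element of N', where f x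
    -- vanishes.
    refine congrArg (fun m => a • m) (hf' x _ _ ?_)
    rw [hs']
    exact (map_smul q.hom b (s n)).trans (congrArg (fun n => b • n) (hs' n))
  obtain ⟨g, hg⟩ := h (z ≫ homPre K q M) (by rw [← Category.assoc, hz, Limits.zero_comp])
  obtain ⟨k, hk⟩ := h' (g ≫ homPre K j M) (by
    rw [show p + 1 - 1 = p by lia, ← Category.assoc, hg, hjq])
  have hc : W.d p (p + 1) ≫ g - W.d p (p + 1) ≫ W.d (p + 1) (p + 1 + 1) ≫
      Projective.factorThru k (homPre K j M) = z ≫ homPre K q M := by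
    rw [hg, ← Category.assoc, W.d_comp_d, Limits.zero_comp, sub_zero]
  -- Subtracting from g the differential of a lift of k leaves its coboundary unchanged and makes it
  -- vanish on N', so it descends to Hom_K(N, M).
  obtain ⟨f, hf⟩ := hlift _ (g - W.d (p + 1) (p + 1 + 1) ≫ Projective.factorThru k (homPre K j M))
    (by rw [Preadditive.sub_comp, Category.assoc, Projective.factorThru_comp, hk, sub_self])
  exact ⟨f, hmono _ _ _ (by rw [Category.assoc, hf, Preadditive.comp_sub, hc])⟩

end Vanishing

/-! ### Vanishing of morphisms from the cone to Hom_K(N, M). -/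

section Vanishing

open DerivedCategory Pretriangulated

lemma shiftedHom_eq_zero_of_cocyclesBound {R : Type u} [Ring R]
    (W : CochainComplex (ModuleCat.{u} R) ℤ) [W.IsKProjective] (X : ModuleCat.{u} R)
    (h : ∀ p, CocyclesBound W X p) {j : ℤ} (f : Q.obj W ⟶ (stalk X)⟦j⟧) : f = 0 := by
  obtain ⟨z, rfl⟩ := cocycleMap_surjective ℤ W X (neg_add_cancel j) f
  exact (cocycleMap_eq_zero_iff ℤ W X _ z).2 (h (-j) z z.2)

lemma cocyclesBound_of_rHomVanishes {R : Type u} [Ring R]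
    (W : CochainComplex (ModuleCat.{u} R) ℤ) [W.IsKProjective] (X : ModuleCat.{u} R)
    (h : RHomVanishes (Q.obj W) (stalk X)) (p : ℤ) : CocyclesBound W X p := fun z hz =>
  (cocycleMap_eq_zero_iff ℤ W X (add_neg_cancel p) ⟨z, hz⟩).1 (h _ _)

variable {K : Type v} [Field K] {A : Type u} [Ring A] [Algebra K A]

lemma cocyclesBound_homBimodule (W : CochainComplex (ModuleCat.{u} (Env K A)) ℤ) (a : ℤ)
    [W.IsStrictlyLE a] [∀ n, Projective (W.X n)] (M : ModuleCat.{u} A)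
    (h : ∀ p, CocyclesBound (((ModuleCat.restrictScalars.{u} (leftHom K A)).mapHomologicalComplex
      (ComplexShape.up ℤ)).obj W) M p) (N : ModuleCat.{u} A) (p : ℤ) :
    CocyclesBound W (homBimodule K N M) p := by
  -- Descending induction from the upper bound a of W: for p > a the term W^p is zero, and each step
  -- trades (p, N) for (p + 1, kernel of a free cover of N). Hence N must vary.
  suffices H : ∀ (n : ℕ) (p : ℤ), a - n < p → ∀ N : ModuleCat.{u} A,
      CocyclesBound W (homBimodule K N M) p from H (a - p + 1).toNat p (by lia) N
  intro n
  induction n with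
  | zero =>
    intro p hp N z _
    exact ⟨0, (W.isZero_of_isStrictlyLE a p (by simpa using hp)).eq_of_src _ _⟩
  | succ n hn =>
    intro p hp N
    let q : ModuleCat.of A (N →₀ A) ⟶ N := ModuleCat.ofHom (Finsupp.linearCombination A id)
    let j : ModuleCat.of A (LinearMap.ker q.hom) ⟶ ModuleCat.of A (N →₀ A) :=
      ModuleCat.ofHom (LinearMap.ker q.hom).subtype
    refine cocyclesBound_step W M p j q Subtype.val_injective
      (LinearMap.exact_subtype_ker_map q.hom) (fun n => ⟨Finsupp.single n 1, ?_⟩)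
      (cocyclesBound_free W M (F := ModuleCat.of A (N →₀ A)) ⟨LinearEquiv.refl A _⟩ p (h p))
      (hn (p + 1) (by lia) _)
    exact (Finsupp.linearCombination_single A 1 n).trans (one_smul A n)

/-- If the cone of a morphism `A → Ω[d]` restricts to a complex of left modules with no morphisms
to `M`, then it has no morphisms to `Hom_K(N, M)`. -/
lemma shiftedHom_homBimodule_eq_zero (C : D (Env K A))
    (W : CochainComplex (ModuleCat.{u} (Env K A)) ℤ) (a : ℤ)
    [W.IsStrictlyLE a] [∀ n, Projective (W.X n)] (e : C ≅ Q.obj W) (M : ModuleCat.{u} A)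
    (h : RHomVanishes ((restrictD (leftHom K A)).obj C) (stalk M)) (N : ModuleCat.{u} A) {j : ℤ}
    (f : C ⟶ (stalk (homBimodule K N M))⟦j⟧) : f = 0 := by
  let R := ModuleCat.restrictScalars.{u} (leftHom K A)
  let W' : CochainComplex (ModuleCat.{u} A) ℤ := (R.mapHomologicalComplex (ComplexShape.up ℤ)).obj W
  have : W.IsKProjective := CochainComplex.isKProjective_of_projective W a
  -- Aᵉ is projective over A, so the restriction of W is again K-projective and computes RHom_A(C,
  -- M).
  have hW' (n : ℤ) : Projective (W'.X n) := projective_restrict_left K A (W.X n)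
  have : W'.IsStrictlyLE a := by
    rw [CochainComplex.isStrictlyLE_iff]
    exact fun n hn => R.map_isZero (W.isZero_of_isStrictlyLE a n)
  have : W'.IsKProjective := CochainComplex.isKProjective_of_projective W' a
  let e' : (restrictD (leftHom K A)).obj C ≅ Q.obj W' :=
    (restrictD (leftHom K A)).mapIso e ≪≫ R.mapDerivedCategoryFactors.app W
  have h' : RHomVanishes (Q.obj W') (stalk M) := fun i g => by
    rw [← cancel_epi e'.hom, h i (e'.hom ≫ g), Limits.comp_zero]
  rw [← cancel_epi e.inv, Limits.comp_zero]
  exact shiftedHom_eq_zero_of_cocyclesBound W _ (cocyclesBound_homBimodule W a M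
    (cocyclesBound_of_rHomVanishes W' M h') N) _

/-- If there are no morphisms from the cone of `ψ` to the shifts of `Y`, then composing with `ψ`
is bijective on morphisms to shifts of `Y`. -/
lemma precomp_bijective_of_cone {R : Type u} [Ring R] (T : Triangle (D R))
    (hT : T ∈ distTriang (D R)) (Y : D R) (h : ∀ (j : ℤ) (f : T.obj₃ ⟶ Y⟦j⟧), f = 0) (j : ℤ) :
    Function.Bijective (fun f : T.obj₂ ⟶ Y⟦j⟧ => T.mor₁ ≫ f) := by
  constructor
  · intro f f' hf
    obtain ⟨g, hg⟩ := T.yoneda_exact₂ hT (f - f') (by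
      rw [Preadditive.comp_sub, sub_eq_zero]
      exact hf)
    rw [h j g, Limits.comp_zero, sub_eq_zero] at hg
    exact hg
  · intro f
    obtain ⟨g, hg⟩ := T.invRotate.yoneda_exact₂ (inv_rot_of_distTriang T hT) f (by
      -- The obstruction to extending f starts at the cone shifted by -1; shifting once more makes
      -- it a morphism from the cone to Y[j + 1], which vanishes.
      let k : T.obj₃⟦(-1 : ℤ)⟧ ⟶ Y⟦j⟧ := T.invRotate.mor₁ ≫ f
      change k = 0
      apply (CategoryTheory.shiftFunctor (D R) (1 : ℤ)).map_injective
      rw [Functor.map_zero, ← cancel_epi ((shiftFunctorCompIsoId (D R) (-1 : ℤ) 1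
          (by lia)).inv.app T.obj₃), ← cancel_mono ((shiftFunctorAdd (D R) j 1).inv.app Y),
        Limits.comp_zero, Limits.zero_comp]
      exact h _ _)
    exact ⟨g, hg.symm⟩

end Vanishing

/-! ### The duality -/

section Main

open DerivedCategory Pretriangulated

variable {K : Type v} [Field K] {A : Type u} [Ring A] [Algebra K A]

/-- Shifting a morphism `Ω ⟶ Y[j]` to a morphism `Ω[d] ⟶ Y[k]`, for `k = j + d`. -/
def shiftHom (K : Type v) [Field K] {R : Type u} [Ring R] [Algebra K R] (Ω Y : D R) (j d k : ℤ)
    (h : j + d = k) : (Ω ⟶ Y⟦j⟧) →ₗ[K] (Ω⟦d⟧ ⟶ Y⟦k⟧) where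
  toFun f := f⟦d⟧' ≫ (shiftFunctorAdd' (D R) j d k h).inv.app Y
  map_add' f g := by simp
  map_smul' c f := by simp [Functor.map_smul]

lemma shiftHom_bijective {R : Type u} [Ring R] [Algebra K R] (Ω Y : D R) (j d k : ℤ)
    (h : j + d = k) : Function.Bijective (shiftHom K Ω Y j d k h) := by
  constructor
  · intro f g hfg
    exact (CategoryTheory.shiftFunctor (D R) d).map_injective
      ((cancel_mono ((shiftFunctorAdd' (D R) j d k h).inv.app Y)).1 hfg)
  · intro f
    obtain ⟨g, hg⟩ := (CategoryTheory.shiftFunctor (D R) d).map_surjective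
      (f ≫ (shiftFunctorAdd' (D R) j d k h).hom.app Y)
    refine ⟨g, ?_⟩
    change g⟦d⟧' ≫ _ = f
    rw [hg]
    simp

lemma shiftHom_postcomp {R : Type u} [Ring R] [Algebra K R] (Ω : D R) {Y Y' : D R} (j d k : ℤ)
    (h : j + d = k) (f : Ω ⟶ Y⟦j⟧) (w : Y ⟶ Y') :
    shiftHom K Ω Y' j d k h (f ≫ w⟦j⟧') = shiftHom K Ω Y j d k h f ≫ w⟦k⟧' := by
  have := (shiftFunctorAdd' (D R) j d k h).inv.naturality w
  change (f ≫ w⟦j⟧')⟦d⟧' ≫ _ = (f⟦d⟧' ≫ _) ≫ _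
  rw [Functor.map_comp, Category.assoc, Category.assoc, ← this]
  rfl

/-- The data which is needed for the duality: a perfect complex `L` quasi-isomorphic to `S`, such
that its dual is quasi-isomorphic to `Ω`, and a morphism `S ⟶ Ω[d]`. -/
structure DualityData (K : Type v) [Field K] (A : Type u) [Ring A] [Algebra K A]
    (S Ω : D (Env K A)) (d : ℤ) where
  /-- the perfect complex -/
  L : CochainComplex (ModuleCat.{u} (Env K A)) ℤ
  finite (n : ℤ) : Module.Finite (Env K A) (L.X n)
  projective (n : ℤ) : Module.Projective (Env K A) (L.X n)
  isKProjective : L.IsKProjective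
  isKProjective_dual : (contraMap (bimoduleDual K A) L).IsKProjective
  /-- the isomorphism with `S` -/
  e : S ≅ Q.obj L
  /-- the isomorphism with `Ω` -/
  ε : Ω ≅ Q.obj (contraMap (bimoduleDual K A) L)
  /-- the morphism to `Ω[d]` -/
  ψ : S ⟶ Ω⟦d⟧

namespace DualityData

attribute [instance] finite projective isKProjective isKProjective_dual

variable {S Ω : D (Env K A)} {d : ℤ} (c : DualityData K A S Ω d)
  {X Y : ModuleCat.{u} (Env K A)} (b : DualPair X Y) (i : ℤ)

/-- The map from the dual of `Hom(S, X[i])` to `Hom(S, Y[d - i])`. -/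
def map : Module.Dual K (S ⟶ (stalk X)⟦i⟧) →ₗ[K] (S ⟶ (stalk Y)⟦d - i⟧) :=
  Linear.leftComp K _ c.ψ ∘ₗ shiftHom K Ω (stalk Y) (-i) d (d - i) (by lia) ∘ₗ
    Linear.leftComp K _ c.ε.hom ∘ₗ (b.duality c.L i).toLinearMap ∘ₗ
      LinearMap.dualMap (Linear.leftComp K ((stalk X)⟦i⟧) c.e.hom)

lemma leftComp_iso_bijective {U V Z : D (Env K A)} (e : U ≅ V) :
    Function.Bijective (Linear.leftComp K Z e.hom) :=
  ⟨fun _ _ h => (cancel_epi e.hom).1 h, fun f => ⟨e.inv ≫ f, e.hom_inv_id_assoc f⟩⟩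

lemma map_bijective (h : Function.Bijective (fun f : Ω⟦d⟧ ⟶ (stalk Y)⟦d - i⟧ => c.ψ ≫ f)) :
    Function.Bijective (c.map b i) :=
  h.comp ((shiftHom_bijective (K := K) _ _ _ _ _ _).comp ((leftComp_iso_bijective c.ε).comp
    ((b.duality c.L i).bijective.comp
      (LinearEquiv.ofBijective _ (leftComp_iso_bijective c.e)).dualMap.bijective)))

lemma map_apply (ξ : Module.Dual K (S ⟶ (stalk X)⟦i⟧)) :
    c.map b i ξ = c.ψ ≫ shiftHom K Ω (stalk Y) (-i) d (d - i) (by lia)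
      (c.ε.hom ≫ b.duality c.L i (ξ ∘ₗ Linear.leftComp K ((stalk X)⟦i⟧) c.e.hom)) := rfl

lemma map_naturality {X' Y' : ModuleCat.{u} (Env K A)} (b' : DualPair X' Y')
    (u : X ⟶ X') (w : Y' ⟶ Y) (huw : ∀ y x, b.equiv (w y) x = b'.equiv y (u x))
    (ξ : Module.Dual K (S ⟶ (stalk X')⟦i⟧)) :
    c.map b i (ξ ∘ₗ Linear.rightComp K _ (((singleFunctor _ 0).map u)⟦i⟧')) =
      c.map b' i ξ ≫ ((singleFunctor _ 0).map w)⟦d - i⟧' := by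
  have h : (ξ ∘ₗ Linear.rightComp K S (((singleFunctor _ 0).map u)⟦i⟧')) ∘ₗ
      Linear.leftComp K ((stalk X)⟦i⟧) c.e.hom =
      (ξ ∘ₗ Linear.leftComp K ((stalk X')⟦i⟧) c.e.hom) ∘ₗ
        Linear.rightComp K _ (((singleFunctor _ 0).map u)⟦i⟧') :=
    LinearMap.ext fun f => congrArg ξ
      (Category.assoc c.e.hom f (((singleFunctor (ModuleCat.{u} (Env K A)) 0).map u)⟦i⟧'))
  rw [map_apply, map_apply, h, b.duality_naturality c.L i b' u w huw, ← Category.assoc,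
    shiftHom_postcomp, Category.assoc]

end DualityData

/-! ### Transport of the duality from bimodules to modules. -/

section

variable {Ω : D (Env K A)} {d : ℤ} (c : DualityData K A (stalk (regularBimodule K A)) Ω d)

/-- The duality isomorphism for modules over `A`. -/
def DualityData.iso (M N : ModuleCat.{u} A) [Module.Finite K M] (i : ℤ)
    (h : Function.Bijective
      (fun f : Ω⟦d⟧ ⟶ (stalk (homBimodule K N M))⟦d - i⟧ => c.ψ ≫ f)) :
    Module.Dual K (ExtZ M N i) ≃ₗ[K] ExtZ N M (d - i) :=
  (LinearEquiv.ofBijective _ (extCompare_bijective K A M N i)).symm.dualMap ≪≫ₗ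
    LinearEquiv.ofBijective _ (c.map_bijective (traceDualPair M N) i h) ≪≫ₗ
      (LinearEquiv.ofBijective _ (extCompare_bijective K A N M (d - i))).symm

lemma DualityData.extCompare_iso (M N : ModuleCat.{u} A) [Module.Finite K M] (i : ℤ)
    (h : Function.Bijective (fun f : Ω⟦d⟧ ⟶ (stalk (homBimodule K N M))⟦d - i⟧ => c.ψ ≫ f))
    (ξ : Module.Dual K (ExtZ M N i))
    (η : Module.Dual K (ExtZ (regularBimodule K A) (homBimodule K M N) i))
    (hη : ∀ x, η (extCompare K A M N i x) = ξ x) :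
    extCompare K A N M (d - i) (c.iso M N i h ξ) = c.map (traceDualPair M N) i η := by
  have h₁ : (LinearEquiv.ofBijective _ (extCompare_bijective K A M N i)).symm.dualMap ξ = η := by
    ext y
    obtain ⟨x, rfl⟩ := (extCompare_bijective K A M N i).2 y
    rw [hη, LinearEquiv.dualMap_apply]
    exact congrArg ξ
      ((LinearEquiv.ofBijective _ (extCompare_bijective K A M N i)).symm_apply_apply x)
  rw [← h₁]
  exact (LinearEquiv.ofBijective _ (extCompare_bijective K A N M (d - i))).apply_symm_apply _

lemma exists_extCompare_dual (M N : ModuleCat.{u} A) (i : ℤ) (ξ : Module.Dual K (ExtZ M N i)) :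
    ∃ η : Module.Dual K (ExtZ (regularBimodule K A) (homBimodule K M N) i),
      ∀ x, η (extCompare K A M N i x) = ξ x :=
  ⟨ξ ∘ₗ (LinearEquiv.ofBijective _ (extCompare_bijective K A M N i)).symm.toLinearMap, fun x =>
    congrArg ξ ((LinearEquiv.ofBijective _ (extCompare_bijective K A M N i)).symm_apply_apply x)⟩

/-- Duality for modules over `A` from duality for bimodules. -/
def functorialDuality (S : ModuleCat.{u} A → Prop) (hS : ∀ M, S M → Module.Finite K M)
    (h : ∀ (M N : ModuleCat.{u} A), S M → ∀ j : ℤ,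
      Function.Bijective (fun f : Ω⟦d⟧ ⟶ (stalk (homBimodule K N M))⟦j⟧ => c.ψ ≫ f)) (i : ℤ) :
    FunctorialDuality (A := A) K S (fun _ => True) i (d - i) where
  iso M N hM _ :=
    haveI := hS M hM
    c.iso M N i (h M N hM _)
  natural_left M M' N hM hM' _ f ξ := by
    have := hS M hM
    have := hS M' hM'
    -- Naturality is checked on bimodules: with ξ written through η, precomposition and
    -- post-composition with f are adjoint for the trace pairings.
    obtain ⟨η, hη⟩ := exists_extCompare_dual M N i ξ
    apply (extCompare_bijective K A N M' (d - i)).1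
    rw [extCompare_naturality_right, c.extCompare_iso M N i (h M N hM _) ξ η hη]
    refine (c.extCompare_iso M' N i (h M' N hM' _) _
      (η ∘ₗ extPost K (regularBimodule K A) (homPre K f N) i) fun x => ?_).trans
      (c.map_naturality _ i (traceDualPair M N) (homPre K f N) (homPost K N f)
        (traceDualPair_homPost_homPre N f) η)
    rw [LinearMap.comp_apply, ← extCompare_naturality_left, hη]
    rfl
  natural_right M N N' hM _ _ g ξ := by
    have := hS M hM
    obtain ⟨η, hη⟩ := exists_extCompare_dual M N' i ξ
    apply (extCompare_bijective K A N M (d - i)).1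
    rw [extCompare_naturality_left, c.extCompare_iso M N' i (h M N' hM _) ξ η hη]
    refine (c.extCompare_iso M N i (h M N hM _) _
      (η ∘ₗ extPost K (regularBimodule K A) (homPost K M g) i) fun x => ?_).trans
      (c.map_naturality _ i (traceDualPair M N') (homPost K M g) (homPre K g M)
        (traceDualPair_homPre_homPost M g) η)
    rw [LinearMap.comp_apply, ← extCompare_naturality_right, hη]
    rfl

end

/-- Restricting a functorial duality to smaller classes of modules. -/
def FunctorialDuality.restrict {S T S' T' : ModuleCat.{u} A → Prop} {i j : ℤ}
    (φ : FunctorialDuality (A := A) K S T i j) (hS : ∀ M, S' M → S M) (hT : ∀ N, T' N → T N) :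
    FunctorialDuality (A := A) K S' T' i j where
  iso M N hM hN := φ.iso M N (hS M hM) (hT N hN)
  natural_left M M' N hM hM' hN := φ.natural_left M M' N (hS M hM) (hS M' hM') (hT N hN)
  natural_right M N N' hM hN hN' := φ.natural_right M N N' (hS M hM) (hT N hN) (hT N' hN')

lemma exists_bounds {R : Type u} [Ring R] (L : CochainComplex (ModuleCat.{u} R) ℤ)
    (h : {n : ℤ | Nontrivial (L.X n)}.Finite) :
    ∃ a : ℤ, ∀ n, a < |n| → Subsingleton (L.X n) := by
  obtain ⟨a, ha⟩ := (h.image abs).bddAbove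
  refine ⟨a, fun n hn => ?_⟩
  by_contra h'
  exact absurd (ha ⟨n, not_subsingleton_iff_nontrivial.1 h', rfl⟩) (not_le.2 hn)

/-- Perfection of A makes both L and its dual bounded complexes of projectives. The cone of ψ is
then represented by a bounded above complex of projectives, as the vanishing argument requires. -/
lemma exists_dualityData (e : A) (d : ℕ) (hA : IsBimoduleInternallyCY K A e d) :
    ∃ c : DualityData K A (stalk (regularBimodule K A)) (inverseDualizing K A) d,
      ∀ (M N : ModuleCat.{u} A), IsFinDim K M ∧ IsQuotientModule e M → ∀ j : ℤ,
        Function.Bijective (fun f : (inverseDualizing K A)⟦(d : ℤ)⟧ ⟶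
          (stalk (homBimodule K N M))⟦j⟧ => c.ψ ≫ f) := by
  obtain ⟨-, ⟨L, hL, hfin, ⟨eL⟩⟩, C, ψ, g, k, hT, hC, -⟩ := hA
  obtain ⟨a, ha⟩ := exists_bounds L hfin
  have hfinite (n : ℤ) : Module.Finite (Env K A) (L.X n) := (hL n).1
  have hproj (n : ℤ) : Module.Projective (Env K A) (L.X n) := (hL n).2
  have hproj' (n : ℤ) : Projective (L.X n) := (L.X n).projective_of_categoryTheory_projective
  let Z := contraMap (bimoduleDual K A) L
  have hprojZ (n : ℤ) : Projective (Z.X n) :=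
    haveI : Module.Projective (Env K A) (Z.X n) := projective_bimoduleDual (L.X (-n))
    (Z.X n).projective_of_categoryTheory_projective
  have hzero (n : ℤ) (hn : a < |n|) : Limits.IsZero (L.X n) :=
    haveI := ha n hn
    ModuleCat.isZero_of_subsingleton _
  -- The terms vanish when |n| > a, a condition symmetric in n, so |a| also bounds the dual complex;
  -- shifting that by d ≥ 0 only lowers its degrees.
  have hLE : L.IsStrictlyLE |a| := by
    rw [CochainComplex.isStrictlyLE_iff]
    exact fun n hn => hzero n (by grind)
  have hLEZ : Z.IsStrictlyLE |a| := by
    rw [CochainComplex.isStrictlyLE_iff]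
    exact fun n hn => (bimoduleDual K A).map_isZero (hzero (-n) (by grind)).op
  have hKL : L.IsKProjective := CochainComplex.isKProjective_of_projective L |a|
  have hKZ : Z.IsKProjective := CochainComplex.isKProjective_of_projective Z |a|
  obtain ⟨ε⟩ := nonempty_inverseDualizing_iso K A L eL
  refine ⟨⟨L, hfinite, hproj, hKL, hKZ, eL, ε, ψ⟩, fun M N hM j => ?_⟩
  have hLEZ' : (Z⟦(d : ℤ)⟧).IsStrictlyLE |a| := by
    rw [CochainComplex.isStrictlyLE_iff]
    exact fun n hn => Z.isZero_of_isStrictlyLE |a| (n + d) (by lia)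
  have hprojZ' (n : ℤ) : Projective ((Z⟦(d : ℤ)⟧).X n) := hprojZ (n + d)
  obtain ⟨W, hW, hW', ⟨eW⟩⟩ := exists_projective_cone _ hT L (Z⟦(d : ℤ)⟧) |a| eL
    ((CategoryTheory.shiftFunctor _ (d : ℤ)).mapIso ε ≪≫ (Q.commShiftIso (d : ℤ)).symm.app Z)
  exact precomp_bijective_of_cone _ hT _ (fun j f => shiftedHom_homBimodule_eq_zero C W |a| eW M
    (hC _ (isFinDimQuotientComplex_stalk e M hM.1 hM.2)) N f) j

end Main

end InternallyCY

end

theorem mainTheorem6 {K : Type v} [Field K] {A : Type u} [Ring A] [Algebra K A]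
    (e : A) (he : IsIdempotentElem e) (d : ℕ)
    (hA : InternallyCY.IsBimoduleInternallyCY K A e d) :
    InternallyCY.IsInternallyCY K A e d ∧
    ∀ i : ℤ, Nonempty (InternallyCY.FunctorialDuality (A := A) K
      (fun M => InternallyCY.IsFinDim K M ∧ InternallyCY.IsQuotientModule e M)
      (fun _ => True) i (d - i)) := by
  obtain ⟨c, hc⟩ := InternallyCY.exists_dualityData e d hA
  let φ := InternallyCY.functorialDuality c _ (fun M hM => hM.1) hc
  -- The duality for all N restricts to the one between perfect modules.
  exact ⟨⟨InternallyCY.globalDimensionLE_of_bimodule K A d hA.1,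
    fun i => ⟨(φ i).restrict (fun _ hM => hM.2) (fun _ _ => trivial)⟩⟩, fun i => ⟨φ i⟩⟩
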